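/- **Theorem.** Let $n,N\in\mathbb N$, let $n_1,\dots,n_N$ and $d_1,\dots,d_N$ be unit vectors in $\mathbb R^n$ with $d_i\cdot n_i>0$ for all $i$, and let $G=\{x\in\mathbb R^n: x\cdot n_i\ge 0,\ i=1,\dots,N\}$. Assume that the origin is a proper vertex of $G$, i.e. there is a unit vector $a_0$ such that $\{x\in G: x\cdot a_0\le 1\}$ is compact. For $x\in G$ put $\mathrm{In}(x)=\{i: x\cdot n_i=0\}$ and $d(x)=\mathrm{cone}\{d_i: i\in \mathrm{In}(x)\}\cap S^{n-1}$, where $\mathrm{cone}$ denotes the set of nonnegative linear combinations, and let $\mathcal C=\mathrm{cone}\{-d_1,\dots,-d_N\}$. Assume: 1. For every nonempty $\lambda\subseteq\{1,\dots,N\}$ there is $d^\lambda\in\mathrm{cone}\{d_i: i\in\lambda\}$ with $d^\lambda\cdot n_i>0$ for all $i\in\lambda$. 2. The Skorohod map is well defined and Lipschitz. That is, for every càdlàg $\psi:[0,\infty)\to\mathbb R^n$ with $\psi(0)\in G$ there is exactly one pair $(\phi,\eta)$ of càdlàg paths $[0,\infty)\to\mathbb R^n$ with $\phi(0)=\psi(0)$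 such that for all $t\ge0$: $\phi(t)=\psi(t)+\eta(t)$; $\phi(t)\in G$; the total variation $|\eta|(t)$ of $\eta$ on $[0,t]$ is finite; $|\eta|(t)=\int_{[0,t]}1_{\{\phi(s)\in\partial G\}}\,d|\eta|(s)$; and there is a Borel measurable $\gamma:[0,\infty)\to\mathbb R^n$, not depending on $t$, with $\gamma(s)\in d(\phi(s))$ for $d|\eta|$-almost every $s$ and $\eta(t)=\int_{[0,t]}\gamma(s)\,d|\eta|(s)$. Writing $\Gamma(\psi)=\phi$, there is a constant $\ell<\infty$ such that $\sup_{t\ge0}|\Gamma(\psi_1)(t)-\Gamma(\psi_2)(t)|\le\ell\,\sup_{t\ge0}|\psi_1(t)-\psi_2(t)|$ for all such $\psi_1,\psi_2$. 3. $\mathcal C_1$ is a nonempty compact subset of the interior of $\mathcal C$. Then there is a function $f:G\to\mathbb R$, of class $C^2$ on $G\setminus\{0\}$ (derivatives being taken within $G\setminus\{0\}$, up to the boundary), which is radially linear, i.e. $f(sx)=sf(x)$ for all $s\in(0,\infty)$ and $x\in G$, and which is a Lyapunov function for the Skorohod problem $(G,d)$ with respect to the set $\mathcal C_1$, i.e.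 (a) for every $K\in(0,\infty)$ there is $M\in(0,\infty)$ such that $f(x)\ge K$ for all $x\in G$ with $|x|\ge M$; (b) for every $\varepsilon>0$ there is $M\in(0,\infty)$ such that $\|D^2f(x)\|\le\varepsilon$ for all $x\in G$ with $|x|\ge M$; (c) there is $c\in(0,\infty)$ such that $Df(x)\cdot r\le -c$ for all $r\in\mathcal C_1$ and $x\in G\setminus\{0\}$, and $Df(x)\cdot d\le -c$ for all $x\in\partial G\setminus\{0\}$ and $d\in d(x)$; (d) there is $L\in(0,\infty)$ such that $|Df(x)|\le L$ for all $x\in G\setminus\{0\}$. -/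

import Mathlib

open Set Filter Topology MeasureTheory
open scoped NNReal ENNReal RealInnerProductSpace

noncomputable section

namespace SkorohodLyapunov

variable {n N : ℕ}

/-- The polyhedral cone `G = ⋂ i, {x | x · nᵢ ≥ 0}` with inward normals `nᵢ = nor i`. -/
def polyCone (nor : Fin N → EuclideanSpace ℝ (Fin n)) : Set (EuclideanSpace ℝ (Fin n)) :=
  {x | ∀ i, 0 ≤ ⟪x, nor i⟫}

/-- The origin is a proper vertex of `G`: for some unit vector `a₀` the truncated cone
`{x ∈ G | x · a₀ ≤ 1}` is compact. -/
def ProperVertex (G : Set (EuclideanSpace ℝ (Fin n))) : Prop :=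
  ∃ a₀ : EuclideanSpace ℝ (Fin n), ‖a₀‖ = 1 ∧ IsCompact {x | x ∈ G ∧ ⟪x, a₀⟫ ≤ 1}

/-- `In(x) = {i | x · nᵢ = 0}`. -/
def activeSet (nor : Fin N → EuclideanSpace ℝ (Fin n)) (x : EuclideanSpace ℝ (Fin n)) :
    Set (Fin N) :=
  {i | ⟪x, nor i⟫ = 0}

/-- `cone {vᵢ | i ∈ I}`, the set of nonnegative linear combinations (it is `{0}` for empty `I`). -/
def coneOf (v : Fin N → EuclideanSpace ℝ (Fin n)) (I : Set (Fin N)) :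
    Set (EuclideanSpace ℝ (Fin n)) :=
  {y | ∃ α : Fin N → ℝ, (∀ i, 0 ≤ α i) ∧ (∀ i, i ∉ I → α i = 0) ∧ y = ∑ i, α i • v i}

/-- The constraint vector field `d(x) = cone {dᵢ | i ∈ In(x)} ∩ Sⁿ⁻¹`. -/
def constraintField (nor dir : Fin N → EuclideanSpace ℝ (Fin n))
    (x : EuclideanSpace ℝ (Fin n)) : Set (EuclideanSpace ℝ (Fin n)) :=
  coneOf dir (activeSet nor x) ∩ Metric.sphere 0 1

/-- The cone `C = cone {-dᵢ | i = 1, …, N}`. -/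
def stabilityCone (dir : Fin N → EuclideanSpace ℝ (Fin n)) : Set (EuclideanSpace ℝ (Fin n)) :=
  coneOf (fun i => -dir i) univ

/-- For each nonempty `S ⊆ {1, …, N}` there is `d^S ∈ cone {dᵢ | i ∈ S}` with
`d^S · nᵢ > 0` for all `i ∈ S`. -/
def CompletelyS (nor dir : Fin N → EuclideanSpace ℝ (Fin n)) : Prop :=
  ∀ S : Set (Fin N), S.Nonempty → ∃ v ∈ coneOf dir S, ∀ i ∈ S, 0 < ⟪v, nor i⟫

/-- Paths on `[0, ∞)` that are right continuous and have limits from the left. -/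
def IsCadlag (ψ : ℝ≥0 → EuclideanSpace ℝ (Fin n)) : Prop :=
  ∀ t, ContinuousWithinAt ψ (Ici t) t ∧ ∃ l, Tendsto ψ (𝓝[<] t) (𝓝 l)

/-- `(φ, η)` solves the Skorohod problem for `ψ` with respect to `G` and `d`. Here `μ` is the
measure `d|η|` on `[0, ∞)`; it is determined by `μ [0, t] = |η|(t) < ∞` for all `t`, and it
exists for every càdlàg `η` of locally bounded variation. -/
def SolvesSP (nor dir : Fin N → EuclideanSpace ℝ (Fin n))
    (ψ φ η : ℝ≥0 → EuclideanSpace ℝ (Fin n)) : Prop :=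
  IsCadlag φ ∧ IsCadlag η ∧ φ 0 = ψ 0 ∧
  (∀ t, φ t = ψ t + η t) ∧
  (∀ t, φ t ∈ polyCone nor) ∧
  (∀ t, eVariationOn η (Icc 0 t) < ∞) ∧
  ∃ μ : Measure ℝ≥0,
    (∀ t, μ (Icc 0 t) = eVariationOn η (Icc 0 t)) ∧
    (∀ t, eVariationOn η (Icc 0 t) =
      ∫⁻ _ in Icc 0 t ∩ {s | φ s ∈ frontier (polyCone nor)}, 1 ∂μ) ∧
    ∃ γ : ℝ≥0 → EuclideanSpace ℝ (Fin n), Measurable γ ∧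
      (∀ᵐ s ∂μ, γ s ∈ constraintField nor dir (φ s)) ∧
      ∀ t, η t = ∫ s in Icc 0 t, γ s ∂μ

/-- The Skorohod map `ψ ↦ φ` is well defined on all càdlàg paths that start in `G` and is
Lipschitz continuous for the supremum norm on `[0, ∞)`. -/
def SkorohodRegular (nor dir : Fin N → EuclideanSpace ℝ (Fin n)) : Prop :=
  (∀ ψ : ℝ≥0 → EuclideanSpace ℝ (Fin n), IsCadlag ψ → ψ 0 ∈ polyCone nor →
    ∃! p : (ℝ≥0 → EuclideanSpace ℝ (Fin n)) × (ℝ≥0 → EuclideanSpace ℝ (Fin n)),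
      SolvesSP nor dir ψ p.1 p.2) ∧
  ∃ ℓ : ℝ≥0, ∀ ψ₁ ψ₂ φ₁ φ₂ η₁ η₂ : ℝ≥0 → EuclideanSpace ℝ (Fin n),
    IsCadlag ψ₁ → IsCadlag ψ₂ → ψ₁ 0 ∈ polyCone nor → ψ₂ 0 ∈ polyCone nor →
    SolvesSP nor dir ψ₁ φ₁ η₁ → SolvesSP nor dir ψ₂ φ₂ η₂ →
      ⨆ t, ‖φ₁ t - φ₂ t‖ₑ ≤ ℓ * ⨆ t, ‖ψ₁ t - ψ₂ t‖ₑ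

/-- `f` is a Lyapunov function for the Skorohod problem `(G, d)` with respect to the set `R` of
mean velocities. Derivatives are taken within `G \ {0}`, i.e. they are one-sided at the boundary;
for `G` with nonempty interior they are unique. The constant `c` is common to all `r ∈ R`. -/
structure IsLyapunovFunction (nor dir : Fin N → EuclideanSpace ℝ (Fin n))
    (R : Set (EuclideanSpace ℝ (Fin n))) (f : EuclideanSpace ℝ (Fin n) → ℝ) : Prop where
  contDiffOn : ContDiffOn ℝ 2 f (polyCone nor \ {0})
  grows : ∀ K : ℝ, 0 < K → ∃ M : ℝ, 0 < M ∧ ∀ x ∈ polyCone nor, M ≤ ‖x‖ → K ≤ f x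
  hessian : ∀ ε : ℝ, 0 < ε → ∃ M : ℝ, 0 < M ∧ ∀ x ∈ polyCone nor, M ≤ ‖x‖ →
    ‖iteratedFDerivWithin ℝ 2 f (polyCone nor \ {0}) x‖ ≤ ε
  decrease : ∃ c : ℝ, 0 < c ∧
    (∀ r ∈ R, ∀ x ∈ polyCone nor \ {0}, fderivWithin ℝ f (polyCone nor \ {0}) x r ≤ -c) ∧
    (∀ x ∈ frontier (polyCone nor) \ {0}, ∀ v ∈ constraintField nor dir x,
      fderivWithin ℝ f (polyCone nor \ {0}) x v ≤ -c)
  gradient : ∃ L : ℝ, 0 < L ∧ ∀ x ∈ polyCone nor \ {0},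
    ‖fderivWithin ℝ f (polyCone nor \ {0}) x‖ ≤ L

/-- `f (s x) = s f(x)` for all `s ∈ (0, ∞)` and `x ∈ G`. -/
def RadiallyLinearOn (G : Set (EuclideanSpace ℝ (Fin n)))
    (f : EuclideanSpace ℝ (Fin n) → ℝ) : Prop :=
  ∀ s : ℝ, 0 < s → ∀ x ∈ G, f (s • x) = s * f x

end SkorohodLyapunov

end

/-! ### Step paths and the discrete-time Skorohod problem -/

namespace SkorohodLyapunov

/-! Let `V x` be the supremum, over discrete trajectories from `x` whose velocities are mean
velocities in `C₁` or constraint directions, of the duration plus the norm of the end point.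
Prefixing a step shows that `V` decreases at unit rate along every admissible velocity, and clearly
`‖x‖ ≤ V x`. Constraint directions may be taken from a point of `G` merely close to the current one;
this tolerance lets the decrease survive smoothing.

The crux is `V x ≤ T * ‖x‖` (`exists_chain_bound`). Since `C₁` lies at a positive distance inside
the cone `C`, the trajectory can be multiplied by weights that grow along the drift, and the
modified drift still lies in `C`. With a drift in `C` the constant path at the vertex solves the
Skorohod problem, because all constraint directions are available there. Comparing with it through
the Lipschitz property (`IsChain.weighted_norm_le`) bounds weight times norm by a multiple of `‖x
0‖`. The growth of the weights then bounds the drift time, and a vector with positive inner product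
with every `dir i` bounds the reflection time.

To regularize, `V` is truncated to be constant near the origin and far away, then mollified
(`exists_smooth_decreasing`). Integrating all rescalings of the result (`radialIntegral`) gives a
function homogeneous of degree one with a uniform decrease (`fderiv_radialIntegral_le`). Homogeneity
and compactness of the unit sphere give growth, the gradient bound and the Hessian decay. -/

theorem isCadlag_comp_floor {n : ℕ} (e : ℕ → EuclideanSpace ℝ (Fin n)) :
    IsCadlag (fun t : ℝ≥0 => e ⌊t⌋₊) := by
  intro t
  constructor
  · have h : (fun s : ℝ≥0 => e ⌊s⌋₊) =ᶠ[𝓝[≥] t] fun _ => e ⌊t⌋₊ := by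
      have h1 : Ico t ((⌊t⌋₊ : ℝ≥0) + 1) ∈ 𝓝[≥] t :=
        Ico_mem_nhdsGE (Nat.lt_floor_add_one t)
      filter_upwards [h1] with s hs
      congr 1
      refine le_antisymm ?_ (Nat.floor_mono hs.1)
      have : ⌊s⌋₊ < ⌊t⌋₊ + 1 := (Nat.floor_lt zero_le).2 (by exact_mod_cast hs.2)
      omega
    exact (continuousWithinAt_const (b := e ⌊t⌋₊)).congr_of_eventuallyEq h rfl
  -- This is the value just before `t`, also at integer times; at `t = 0` the left neighbourhood
  -- filter is trivial.
  · refine ⟨e (⌈t⌉₊ - 1), ?_⟩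
    have h : (fun s : ℝ≥0 => e ⌊s⌋₊) =ᶠ[𝓝[<] t] fun _ => e (⌈t⌉₊ - 1) := by
      rcases eq_or_ne t 0 with rfl | ht
      · simp [EventuallyEq]
      have ht0 : 0 < ⌈t⌉₊ := Nat.ceil_pos.2 (pos_iff_ne_zero.2 ht)
      have h2 : ((⌈t⌉₊ - 1 : ℕ) : ℝ≥0) < t := Nat.lt_ceil.1 (by omega)
      filter_upwards [Ico_mem_nhdsLT h2] with s hs
      congr 1
      refine le_antisymm ?_ (Nat.le_floor hs.1)
      have : ⌊s⌋₊ < ⌈t⌉₊ := (Nat.floor_lt zero_le).2 (hs.2.trans_le (Nat.le_ceil t))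
      omega
    exact tendsto_const_nhds.congr' h.symm

theorem eVariationOn_comp_floor {n : ℕ} (e : ℕ → EuclideanSpace ℝ (Fin n)) (t : ℝ≥0) :
    eVariationOn (fun s : ℝ≥0 => e ⌊s⌋₊) (Icc 0 t) =
      ∑ k ∈ Finset.range ⌊t⌋₊, ‖e (k + 1) - e k‖ₑ := by
  have h := eVariationOn.comp_eq_of_monotoneOn e (t := Icc 0 t) (fun s : ℝ≥0 => ⌊s⌋₊)
    (fun a _ b _ hab => Nat.floor_mono hab)
  have himg : (fun s : ℝ≥0 => ⌊s⌋₊) '' Icc 0 t = id '' Iic ⌊t⌋₊ := by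
    ext k
    simp only [mem_image, mem_Icc, zero_le, true_and, id, exists_eq_right, mem_Iic]
    constructor
    · rintro ⟨s, hs, rfl⟩
      exact Nat.floor_mono hs
    · intro hk
      exact ⟨k, (Nat.cast_le.2 hk).trans (Nat.floor_le zero_le), Nat.floor_natCast k⟩
  rw [himg, eVariationOn.image_range_of_monotone e monotone_id] at h
  refine h.trans (Finset.sum_congr rfl fun k _ => ?_)
  simp only [id, edist_comm (e k), edist_eq_enorm_sub]

theorem sum_range_ite_lt {M : Type*} [AddCommMonoid M] {m : ℕ} (F : ℕ → M)
    (hF : ∀ k, m ≤ k → F k = 0) (N : ℕ) :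
    ∑ k ∈ Finset.range m, (if k < N then F k else 0) = ∑ k ∈ Finset.range N, F k := by
  rw [← Finset.sum_filter]
  refine Finset.sum_subset_zero_on_sdiff ?_ ?_ (fun _ _ => rfl)
  · intro k hk
    simp only [Finset.mem_filter, Finset.mem_range] at hk ⊢
    exact hk.2
  · intro k hk
    simp only [Finset.mem_sdiff, Finset.mem_filter, Finset.mem_range, not_and] at hk
    exact hF k (by by_contra! h; exact hk.2 h hk.1)

theorem isClosed_polyCone {n N : ℕ} (nor : Fin N → EuclideanSpace ℝ (Fin n)) :
    IsClosed (polyCone nor) := by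
  simp only [polyCone, ofPred_forall]
  exact isClosed_iInter fun i => isClosed_le continuous_const (by fun_prop)

theorem mem_frontier_polyCone {n N : ℕ} {nor : Fin N → EuclideanSpace ℝ (Fin n)}
    (hnor : ∀ i, ‖nor i‖ = 1) {x : EuclideanSpace ℝ (Fin n)} (hx : x ∈ polyCone nor)
    {i : Fin N} (hi : i ∈ activeSet nor x) : x ∈ frontier (polyCone nor) := by
  rw [(isClosed_polyCone nor).frontier_eq]
  refine ⟨hx, fun hint => ?_⟩
  have hc : Tendsto (fun t : ℝ => x - t • nor i) (𝓝[>] 0) (𝓝 x) := by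
    have : Continuous fun t : ℝ => x - t • nor i := by fun_prop
    simpa using (this.tendsto 0).mono_left nhdsWithin_le_nhds
  obtain ⟨t, ht, ht0⟩ :=
    ((hc.eventually (mem_interior_iff_mem_nhds.1 hint)).and self_mem_nhdsWithin).exists
  have h1 := ht i
  have h2 : ⟪x, nor i⟫ = 0 := hi
  rw [inner_sub_left, h2, real_inner_smul_left, real_inner_self_eq_norm_sq, hnor i] at h1
  have : (0 : ℝ) < t := ht0
  linarith

theorem smul_mem_coneOf {n N : ℕ} {v : Fin N → EuclideanSpace ℝ (Fin n)} {I : Set (Fin N)}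
    {y : EuclideanSpace ℝ (Fin n)} (hy : y ∈ coneOf v I) {c : ℝ} (hc : 0 ≤ c) :
    c • y ∈ coneOf v I := by
  obtain ⟨α, h0, h1, rfl⟩ := hy
  refine ⟨fun i => c * α i, fun i => mul_nonneg hc (h0 i), fun i hi => by simp [h1 i hi], ?_⟩
  simp [Finset.smul_sum, mul_smul]

theorem zero_mem_coneOf {n N : ℕ} (v : Fin N → EuclideanSpace ℝ (Fin n)) (I : Set (Fin N)) :
    0 ∈ coneOf v I :=
  ⟨fun _ => 0, by simp, by simp, by simp⟩

/-- A discrete-time solution of the Skorohod problem gives, through its step paths, a solution in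
continuous time. -/
theorem solvesSP_step {n N : ℕ} {nor dir : Fin N → EuclideanSpace ℝ (Fin n)}
    (hnor : ∀ i, ‖nor i‖ = 1) (Y e : ℕ → EuclideanSpace ℝ (Fin n)) (m : ℕ)
    (hY : ∀ k, Y k ∈ polyCone nor) (he0 : e 0 = 0)
    (he : ∀ k, e (k + 1) - e k ∈ coneOf dir (activeSet nor (Y (k + 1))))
    (hm : ∀ k, m ≤ k → e (k + 1) = e k) :
    SolvesSP nor dir (fun t => Y ⌊t⌋₊ - e ⌊t⌋₊) (fun t => Y ⌊t⌋₊) (fun t => e ⌊t⌋₊) := by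
  set δ : ℕ → EuclideanSpace ℝ (Fin n) := fun k => e (k + 1) - e k with hδ
  have hδm : ∀ k, m ≤ k → δ k = 0 := fun k hk => by simp [hδ, hm k hk]
  -- The jump `δ k` occurs at time `k + 1`; hence the density below is the normalized jump with
  -- index `⌊s⌋₊ - 1`.
  set μ : Measure ℝ≥0 := ∑ k ∈ Finset.range m, ‖δ k‖ₑ • Measure.dirac ((k + 1 : ℕ) : ℝ≥0) with hμ
  have hfl : ∀ (k : ℕ) (t : ℝ≥0), ((k + 1 : ℕ) : ℝ≥0) ∈ Icc 0 t ↔ k < ⌊t⌋₊ := by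
    intro k t
    rw [mem_Icc, and_iff_right zero_le, ← Nat.le_floor_iff zero_le, Nat.succ_le_iff]
  have hμIcc : ∀ t, μ (Icc 0 t) = eVariationOn (fun s : ℝ≥0 => e ⌊s⌋₊) (Icc 0 t) := by
    intro t
    rw [eVariationOn_comp_floor, ← sum_range_ite_lt (m := m) _
      (fun k hk => by have := hδm k hk; simp only [hδ] at this; simp [this]), hμ]
    simp only [Measure.coe_finsetSum, Finset.sum_apply, Measure.smul_apply, smul_eq_mul]
    refine Finset.sum_congr rfl fun k _ => ?_
    rw [Measure.dirac_apply' _ measurableSet_Icc, indicator_apply]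
    simp only [hfl]
    split_ifs <;> simp [hδ]
  have hae : ∀ {P : ℝ≥0 → Prop}, (∀ k, δ k ≠ 0 → P ((k + 1 : ℕ) : ℝ≥0)) → ∀ᵐ s ∂μ, P s := by
    intro P hP
    rw [ae_iff, hμ]
    simp only [Measure.coe_finsetSum, Finset.sum_apply, Measure.smul_apply, smul_eq_mul]
    refine Finset.sum_eq_zero fun k _ => ?_
    by_cases hk : δ k = 0
    · simp [hk]
    · have : (Measure.dirac ((k + 1 : ℕ) : ℝ≥0)) {a | ¬ P a} = 0 := by
        rw [Measure.dirac_apply]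
        exact indicator_of_notMem (by simpa using hP k hk) _
      rw [this, mul_zero]
  refine ⟨isCadlag_comp_floor Y, isCadlag_comp_floor e, by simp [he0], fun t => by simp,
    fun t => hY _, fun t => ?_, μ, hμIcc, fun t => ?_,
    fun s => ‖δ (⌊s⌋₊ - 1)‖⁻¹ • δ (⌊s⌋₊ - 1), ?_, ?_, fun t => ?_⟩
  · rw [eVariationOn_comp_floor]
    exact ENNReal.sum_lt_top.2 fun k _ => enorm_lt_top
  · rw [setLIntegral_one, ← hμIcc]
    refine (measure_congr ?_)
    have : ∀ᵐ s ∂μ, Y ⌊s⌋₊ ∈ frontier (polyCone nor) := by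
      refine hae fun k hk => ?_
      rw [Nat.floor_natCast]
      by_contra hcon
      obtain ⟨α, -, h1, h2⟩ := he k
      refine hk (h2.trans (Finset.sum_eq_zero fun i _ => ?_))
      rw [h1 i (fun hi => hcon (mem_frontier_polyCone hnor (hY _) hi)), zero_smul]
    filter_upwards [this] with s hs
    simp only [eq_iff_iff]
    exact ⟨fun h => ⟨h, hs⟩, fun h => h.1⟩
  · exact (measurable_of_countable fun k : ℕ => ‖δ (k - 1)‖⁻¹ • δ (k - 1)).comp
      Nat.measurable_floor
  · refine hae fun k hk => ?_
    simp only [Nat.floor_natCast, Nat.add_sub_cancel]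
    refine ⟨smul_mem_coneOf (he k) (by positivity), ?_⟩
    rw [mem_sphere_zero_iff_norm, norm_smul, norm_inv, norm_norm,
      inv_mul_cancel₀ (norm_ne_zero_iff.2 hk)]
  · have h1 : e ⌊t⌋₊ = ∑ k ∈ Finset.range ⌊t⌋₊, δ k := by
      rw [Finset.sum_range_sub, he0, sub_zero]
    dsimp only
    rw [h1, ← sum_range_ite_lt (m := m) _ hδm, ← integral_indicator measurableSet_Icc, hμ,
      integral_finsetSum_measure fun k _ =>
        (integrable_dirac (by simp)).smul_measure enorm_ne_top]
    refine Finset.sum_congr rfl fun k _ => ?_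
    classical
    rw [integral_smul_measure, integral_dirac, indicator_apply]
    simp only [hfl, Nat.floor_natCast, Nat.add_sub_cancel, toReal_enorm]
    split_ifs with h
    · by_cases hk : δ k = 0
      · simp [hk]
      · rw [smul_smul, mul_inv_cancel₀ (norm_ne_zero_iff.2 hk), one_smul]
    · simp

/-- The Lipschitz property of the Skorohod map in discrete time, on a finite horizon. -/
theorem exists_discrete_lipschitz {n N : ℕ} {nor dir : Fin N → EuclideanSpace ℝ (Fin n)}
    (hnor : ∀ i, ‖nor i‖ = 1) (hreg : SkorohodRegular nor dir) :
    ∃ ℓ : ℝ, 0 ≤ ℓ ∧ ∀ (m : ℕ) (Y e Y' e' : ℕ → EuclideanSpace ℝ (Fin n)) (D : ℝ),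
      (∀ k ≤ m, Y k ∈ polyCone nor) → (∀ k ≤ m, Y' k ∈ polyCone nor) → e 0 = 0 → e' 0 = 0 →
      (∀ k < m, e (k + 1) - e k ∈ coneOf dir (activeSet nor (Y (k + 1)))) →
      (∀ k < m, e' (k + 1) - e' k ∈ coneOf dir (activeSet nor (Y' (k + 1)))) →
      (∀ k ≤ m, ‖(Y k - e k) - (Y' k - e' k)‖ ≤ D) → ∀ k ≤ m, ‖Y k - Y' k‖ ≤ ℓ * D := by
  obtain ⟨-, ℓ, hℓ⟩ := hreg
  refine ⟨ℓ, ℓ.2, fun m Y e Y' e' D hY hY' h0 h0' he he' hD k hk => ?_⟩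
  -- Freezing both sequences after `m` extends them to an infinite horizon, with zero increments
  -- beyond `m`.
  have hinc : ∀ Y e : ℕ → EuclideanSpace ℝ (Fin n),
      (∀ k < m, e (k + 1) - e k ∈ coneOf dir (activeSet nor (Y (k + 1)))) → ∀ k,
      e (min (k + 1) m) - e (min k m) ∈ coneOf dir (activeSet nor (Y (min (k + 1) m))) := by
    intro Y e h k
    by_cases hk : k < m
    · rw [min_eq_left (by omega : k + 1 ≤ m), min_eq_left hk.le]
      exact h k hk
    · rw [min_eq_right (by omega : m ≤ k + 1), min_eq_right (by omega : m ≤ k), sub_self]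
      exact zero_mem_coneOf _ _
  have hsol : ∀ Y e : ℕ → EuclideanSpace ℝ (Fin n), (∀ k ≤ m, Y k ∈ polyCone nor) → e 0 = 0 →
      (∀ k < m, e (k + 1) - e k ∈ coneOf dir (activeSet nor (Y (k + 1)))) → _ :=
    fun Y e hY h0 he => solvesSP_step (dir := dir) hnor (fun k => Y (min k m))
      (fun k => e (min k m)) m
      (fun k => hY _ (min_le_right _ _)) (by simpa using h0) (hinc Y e he)
      (fun k hk => by rw [min_eq_right (by omega : m ≤ k + 1), min_eq_right hk])
  have key := hℓ _ _ _ _ _ _ (isCadlag_comp_floor fun k => Y (min k m) - e (min k m))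
    (isCadlag_comp_floor fun k => Y' (min k m) - e' (min k m))
    (by simpa [h0] using hY 0 zero_le) (by simpa [h0'] using hY' 0 zero_le)
    (hsol Y e hY h0 he) (hsol Y' e' hY' h0' he')
  have hD0 : 0 ≤ D := (norm_nonneg _).trans (hD 0 zero_le)
  have h1 : ‖Y k - Y' k‖ₑ ≤ ℓ * ENNReal.ofReal D := by
    refine le_trans (le_trans ?_ (le_iSup _ (k : ℝ≥0))) (key.trans ?_)
    · simp [min_eq_left hk]
    · refine mul_le_mul_right (iSup_le fun t => ?_) _
      rw [← ofReal_norm]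
      exact ENNReal.ofReal_le_ofReal (hD _ (min_le_right _ _))
  rw [← ofReal_norm, ← ENNReal.ofReal_coe_nnreal, ← ENNReal.ofReal_mul ℓ.coe_nonneg] at h1
  exact (ENNReal.ofReal_le_ofReal_iff (mul_nonneg ℓ.2 hD0)).1 h1

/-! ### Consequences of the completely-S condition -/

/-- If every principal submatrix of `(⟪dir j, nor i⟫)` is an `S`-matrix, then no nonzero nonnegative
vector is mapped to a vector that is nonpositive on its support. -/
theorem CompletelyS.eq_zero_of_nonpos {n N : ℕ} {nor dir : Fin N → EuclideanSpace ℝ (Fin n)}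
    (hS : CompletelyS nor dir) {α : Fin N → ℝ} (h0 : ∀ i, 0 ≤ α i)
    (hα : ∀ i, α i ≠ 0 → ⟪∑ j, α j • dir j, nor i⟫ ≤ 0) : α = 0 := by
  classical
  induction hc : (Finset.univ.filter fun i => α i ≠ 0).card using Nat.strong_induction_on
    generalizing α with
  | _ c ih =>
  by_contra hne
  obtain ⟨i₀, hi₀⟩ : ∃ i, α i ≠ 0 := by simpa [funext_iff] using hne
  obtain ⟨v, ⟨β, hβ0, hβ, rfl⟩, hv⟩ := hS {i | α i ≠ 0} ⟨i₀, hi₀⟩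
  have hβne : (Finset.univ.filter fun i => 0 < β i).Nonempty := by
    by_contra hcon
    have hz : ∀ i, β i = 0 := fun i => by
      by_contra hi
      exact hcon ⟨i, by simpa using lt_of_le_of_ne (hβ0 i) (Ne.symm hi)⟩
    have := hv i₀ hi₀
    simp [hz] at this
  -- The minimal ratio `s` keeps `α - s β` nonnegative and removes `j` from the support. The
  -- inequalities become strict on the old support, so the vanishing of `α - s β` given by induction
  -- is a contradiction.
  obtain ⟨j, hj, hmin⟩ := Finset.exists_min_image _ (fun i => α i / β i) hβne
  simp only [Finset.mem_filter, Finset.mem_univ, true_and] at hj hmin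
  have hαj : α j ≠ 0 := by
    by_contra hcon
    exact hj.ne' (hβ j (by simpa using hcon))
  set s := α j / β j with hs
  have hs0 : 0 < s := div_pos (lt_of_le_of_ne (h0 j) hαj.symm) hj
  have hsupp : ∀ i, α i - s * β i ≠ 0 → α i ≠ 0 := by
    intro i hi hi'
    exact hi (by simp [hi', hβ i (by simpa using hi')])
  have hneg : ∀ i, α i ≠ 0 → ⟪∑ k, (α k - s * β k) • dir k, nor i⟫ < 0 := by
    intro i hi
    have h1 : ∑ k, (α k - s * β k) • dir k = ∑ k, α k • dir k - s • ∑ k, β k • dir k := by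
      simp [sub_smul, Finset.smul_sum, mul_smul]
    rw [h1, inner_sub_left, real_inner_smul_left]
    have := mul_pos hs0 (hv i hi)
    linarith [hα i hi]
  have hγ := ih _ (by
    rw [← hc]
    refine Finset.card_lt_card ⟨fun i hi => ?_, fun hsub => ?_⟩
    · simpa using hsupp i (by simpa using hi)
    · have := hsub (show j ∈ Finset.univ.filter fun i => α i ≠ 0 by simpa using hαj)
      simp [hs, div_mul_cancel₀ _ hj.ne'] at this) (α := fun k => α k - s * β k)
    (fun i => by
      rcases (hβ0 i).eq_or_lt with h | h
      · simpa [← h] using h0 i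
      · have := (le_div_iff₀ h).1 (hmin i h)
        linarith)
    (fun i hi => (hneg i (hsupp i hi)).le) rfl
  have := hneg i₀ hi₀
  have h2 : ∀ k, α k - s * β k = 0 := fun k => congrFun hγ k
  simp [h2] at this

/-- The origin is not in the convex hull of the `dir i`, by `CompletelyS.eq_zero_of_nonpos`, so a
hyperplane strictly separates it from this compact set. -/
theorem CompletelyS.exists_inner_pos {n N : ℕ} {nor dir : Fin N → EuclideanSpace ℝ (Fin n)}
    (hS : CompletelyS nor dir) :
    ∃ (w : EuclideanSpace ℝ (Fin n)) (c : ℝ), 0 < c ∧ ∀ i, c ≤ ⟪w, dir i⟫ := by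
  set L : (Fin N → ℝ) →ₗ[ℝ] EuclideanSpace ℝ (Fin n) := Fintype.linearCombination ℝ dir with hL
  have hLc : Continuous L := L.continuous_of_finiteDimensional
  have h0 : (0 : EuclideanSpace ℝ (Fin n)) ∉ L '' stdSimplex ℝ (Fin N) := by
    rintro ⟨α, ⟨hα0, hα1⟩, hα⟩
    rw [hL, Fintype.linearCombination_apply] at hα
    have := hS.eq_zero_of_nonpos hα0 fun i _ => by rw [hα]; simp
    simp [this] at hα1
  obtain ⟨f, u, hu, hf⟩ := geometric_hahn_banach_point_closed
    ((convex_stdSimplex ℝ (Fin N)).linear_image L)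
    ((isCompact_stdSimplex ℝ (Fin N)).image hLc).isClosed h0
  refine ⟨(InnerProductSpace.toDual ℝ _).symm f, u, by simpa using hu, fun i => ?_⟩
  rw [InnerProductSpace.toDual_symm_apply]
  refine (hf _ ⟨Pi.single i 1, single_mem_stdSimplex ℝ i, ?_⟩).le
  simp [hL]

/-- A unit vector in the cone of the unit vectors `dir i` has coefficients of sum at least one, by
the triangle inequality. -/
theorem le_inner_of_mem_constraintField {n N : ℕ} {nor dir : Fin N → EuclideanSpace ℝ (Fin n)}
    (hdir : ∀ i, ‖dir i‖ = 1) {w : EuclideanSpace ℝ (Fin n)} {c : ℝ} (hc : 0 < c)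
    (hw : ∀ i, c ≤ ⟪w, dir i⟫) {x v : EuclideanSpace ℝ (Fin n)}
    (hv : v ∈ constraintField nor dir x) : c ≤ ⟪w, v⟫ := by
  obtain ⟨⟨α, h0, -, rfl⟩, h1⟩ := hv
  rw [mem_sphere_zero_iff_norm] at h1
  have h2 : 1 ≤ ∑ i, α i := by
    rw [← h1]
    refine (norm_sum_le _ _).trans (Finset.sum_le_sum fun i _ => ?_)
    rw [norm_smul, hdir i, mul_one, Real.norm_of_nonneg (h0 i)]
  rw [inner_sum]
  calc c ≤ (∑ i, α i) * c := le_mul_of_one_le_left hc.le h2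
    _ = ∑ i, α i * c := Finset.sum_mul _ _ _
    _ ≤ _ := Finset.sum_le_sum fun i _ => by
      rw [real_inner_smul_right]
      exact mul_le_mul_of_nonneg_left (hw i) (h0 i)

theorem activeSet_smul {n N : ℕ} (nor : Fin N → EuclideanSpace ℝ (Fin n))
    (x : EuclideanSpace ℝ (Fin n)) {s : ℝ} (hs : 0 < s) :
    activeSet nor (s • x) = activeSet nor x := by
  ext i
  simp [activeSet, real_inner_smul_left, hs.ne']

theorem smul_mem_polyCone {n N : ℕ} {nor : Fin N → EuclideanSpace ℝ (Fin n)}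
    {x : EuclideanSpace ℝ (Fin n)} (hx : x ∈ polyCone nor) {s : ℝ} (hs : 0 ≤ s) :
    s • x ∈ polyCone nor := fun i => by
  rw [real_inner_smul_left]
  exact mul_nonneg hs (hx i)

theorem constraintField_smul {n N : ℕ} (nor dir : Fin N → EuclideanSpace ℝ (Fin n))
    (x : EuclideanSpace ℝ (Fin n)) {s : ℝ} (hs : 0 < s) :
    constraintField nor dir (s • x) = constraintField nor dir x := by
  rw [constraintField, activeSet_smul nor x hs, constraintField]

theorem neg_mem_coneOf_of_mem_stabilityCone {n N : ℕ}
    {nor dir : Fin N → EuclideanSpace ℝ (Fin n)} {v : EuclideanSpace ℝ (Fin n)}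
    (hv : v ∈ stabilityCone dir) : -v ∈ coneOf dir (activeSet nor 0) := by
  obtain ⟨α, h0, -, rfl⟩ := hv
  exact ⟨α, h0, fun i hi => absurd (by simp [activeSet]) hi, by simp⟩

/-! ### Approximate trajectories and their duration -/

/-- An approximate discrete trajectory of length `m`: each step moves by `h k • v k`, where `v k` is
a mean velocity or a constraint direction at a point `y k` of the cone close to `x k`. -/
structure IsChain {n N : ℕ} (nor dir : Fin N → EuclideanSpace ℝ (Fin n))
    (R : Set (EuclideanSpace ℝ (Fin n))) (ε : ℝ) (m : ℕ)
    (x y v : ℕ → EuclideanSpace ℝ (Fin n)) (h : ℕ → ℝ) : Prop where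
  mem : ∀ k < m, y k ∈ polyCone nor
  near : ∀ k < m, ‖y k - x k‖ ≤ ε * ‖x k‖
  nonneg : ∀ k < m, 0 ≤ h k
  small : ∀ k < m, h k ≤ ε * ‖x k‖
  velocity : ∀ k < m, v k ∈ R ∨ v k ∈ constraintField nor dir (y k)
  step : ∀ k < m, x (k + 1) = x k + h k • v k

section

variable {n N : ℕ} {nor dir : Fin N → EuclideanSpace ℝ (Fin n)}
  {R : Set (EuclideanSpace ℝ (Fin n))} {ε δ ρ : ℝ} {m : ℕ}
  {x y v : ℕ → EuclideanSpace ℝ (Fin n)} {h : ℕ → ℝ}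

theorem IsChain.norm_velocity_le (H : IsChain nor dir R ε m x y v h) (hρ1 : 1 ≤ ρ)
    (hρ : ∀ r ∈ R, ‖r‖ ≤ ρ) {k : ℕ} (hk : k < m) : ‖v k‖ ≤ ρ := by
  rcases H.velocity k hk with hv | hv
  · exact hρ _ hv
  · rw [mem_sphere_zero_iff_norm.1 hv.2]
    exact hρ1

/-- In the discrete Skorohod problem an increment must be admissible at the point reached, while a
chain takes its direction at the point left. The shift to `y (k - 1)` repairs this; at `k = 0`
truncated subtraction gives `y 0`. -/
theorem IsChain.norm_sub_pred_le (H : IsChain nor dir R ε m x y v h) (hm : 0 < m) (hε : 0 ≤ ε)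
    (hρ1 : 1 ≤ ρ) (hρ : ∀ r ∈ R, ‖r‖ ≤ ρ) (hερ : ε * ρ ≤ 1 / 2) {k : ℕ} (hk : k ≤ m) :
    ‖y (k - 1) - x k‖ ≤ 2 * ε * (1 + ρ) * ‖x k‖ := by
  rcases k with _ | k
  · refine (H.near 0 hm).trans ?_
    have : 0 ≤ ε * ‖x 0‖ := by positivity
    nlinarith
  · have hk' : k < m := hk
    have h1 : ‖h k • v k‖ ≤ ε * ρ * ‖x k‖ := by
      rw [norm_smul, Real.norm_of_nonneg (H.nonneg k hk')]
      calc h k * ‖v k‖ ≤ (ε * ‖x k‖) * ρ :=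
            mul_le_mul (H.small k hk') (H.norm_velocity_le hρ1 hρ hk') (norm_nonneg _)
              (by positivity)
        _ = _ := by ring
    have h2 : ‖x k‖ ≤ 2 * ‖x (k + 1)‖ := by
      have h3 : x k = x (k + 1) - h k • v k := by rw [H.step k hk']; abel
      have h4 := norm_sub_le (x (k + 1)) (h k • v k)
      rw [← h3] at h4
      nlinarith [norm_nonneg (x k)]
    have h5 : y k - x (k + 1) = (y k - x k) - h k • v k := by rw [H.step k hk']; abel
    rw [Nat.add_sub_cancel, h5]
    calc _ ≤ ‖y k - x k‖ + ‖h k • v k‖ := norm_sub_le _ _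
      _ ≤ ε * ‖x k‖ + ε * ρ * ‖x k‖ := add_le_add (H.near k hk') h1
      _ = ε * (1 + ρ) * ‖x k‖ := by ring
      _ ≤ ε * (1 + ρ) * (2 * ‖x (k + 1)‖) := by gcongr
      _ = _ := by ring

open Classical in
/-- The growing weights along a chain which compensate the inward drift of its mean velocities. -/
noncomputable def chainWeight (R : Set (EuclideanSpace ℝ (Fin n))) (δ : ℝ)
    (x v : ℕ → EuclideanSpace ℝ (Fin n)) (h : ℕ → ℝ) (k : ℕ) : ℝ :=
  ∏ j ∈ Finset.range k, (1 + δ * (if v j ∈ R then h j else 0) / ‖x j‖)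

theorem chainWeight_succ_of_mem {k : ℕ} (hk : v k ∈ R) :
    chainWeight R δ x v h (k + 1) = chainWeight R δ x v h k * (1 + δ * h k / ‖x k‖) := by
  simp [chainWeight, Finset.prod_range_succ, hk]

theorem chainWeight_succ_of_notMem {k : ℕ} (hk : v k ∉ R) :
    chainWeight R δ x v h (k + 1) = chainWeight R δ x v h k := by
  simp [chainWeight, Finset.prod_range_succ, hk]

theorem IsChain.one_le_chainWeight (H : IsChain nor dir R ε m x y v h) (hδ : 0 ≤ δ) {k : ℕ}
    (hk : k ≤ m) : 1 ≤ chainWeight R δ x v h k := by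
  induction k with
  | zero => simp [chainWeight]
  | succ k ih =>
    have h1 := ih (by omega)
    by_cases hv : v k ∈ R
    · rw [chainWeight_succ_of_mem hv]
      refine one_le_mul_of_one_le_of_one_le h1 ?_
      have := H.nonneg k hk
      have : 0 ≤ δ * h k / ‖x k‖ := by positivity
      linarith
    · rwa [chainWeight_succ_of_notMem hv]

/-- The weighted chain is, up to a small relative error, a reflected path whose drift lies in the
stability cone. The zero path solves the problem for the same drift without the initial value `x 0`,
so the Lipschitz property controls the former by `‖x 0‖`. -/
theorem IsChain.weighted_norm_le (H : IsChain nor dir R ε m x y v h) (hm : 0 < m) (hε : 0 ≤ ε)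
    (hρ1 : 1 ≤ ρ) (hρ : ∀ r ∈ R, ‖r‖ ≤ ρ) (hερ : ε * ρ ≤ 1 / 2) (hδ : 0 ≤ δ)
    (hR : ∀ r ∈ R, ∀ u, ‖u‖ ≤ δ → r + u ∈ stabilityCone dir) {ℓ : ℝ}
    (hℓ : ∀ (m : ℕ) (Y e Y' e' : ℕ → EuclideanSpace ℝ (Fin n)) (D : ℝ),
      (∀ k ≤ m, Y k ∈ polyCone nor) → (∀ k ≤ m, Y' k ∈ polyCone nor) → e 0 = 0 → e' 0 = 0 →
      (∀ k < m, e (k + 1) - e k ∈ coneOf dir (activeSet nor (Y (k + 1)))) →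
      (∀ k < m, e' (k + 1) - e' k ∈ coneOf dir (activeSet nor (Y' (k + 1)))) →
      (∀ k ≤ m, ‖(Y k - e k) - (Y' k - e' k)‖ ≤ D) → ∀ k ≤ m, ‖Y k - Y' k‖ ≤ ℓ * D)
    (hεℓ : 2 * ε * (1 + ρ) * (1 + ℓ) ≤ 1 / 2) {k : ℕ} (hk : k ≤ m) :
    chainWeight R δ x v h k * ‖x k‖ ≤ 2 * ℓ * ‖x 0‖ := by
  classical
  set μ := chainWeight R δ x v h with hμ
  have hμ1 : ∀ k ≤ m, 1 ≤ μ k := fun k hk => H.one_le_chainWeight hδ hk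
  have hμ0 : μ 0 = 1 := by simp [hμ, chainWeight]
  set p : ℕ → EuclideanSpace ℝ (Fin n) := fun j => if v j ∈ R then v j else 0 with hp
  set q : ℕ → EuclideanSpace ℝ (Fin n) := fun j => if v j ∈ R then 0 else v j with hq
  have hpq : ∀ j, p j + q j = v j := fun j => by
    simp only [hp, hq]
    split_ifs <;> simp
  -- The increment of `μ k • x k` splits into a drift part `c`, which absorbs the growth of the
  -- weight, and a reflection part `r`.
  set c : ℕ → EuclideanSpace ℝ (Fin n) := fun j =>
    (μ (j + 1) * h j) • p j + (μ (j + 1) - μ j) • x j with hc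
  set r : ℕ → EuclideanSpace ℝ (Fin n) := fun j => (μ (j + 1) * h j) • q j with hr
  have hcC : ∀ j < m, c j ∈ stabilityCone dir := by
    intro j hj
    by_cases hv : v j ∈ R
    · have h1 : c j = (μ (j + 1) * h j) • (v j + (μ j / μ (j + 1) * δ * ‖x j‖⁻¹) • x j) := by
        have h2 : μ (j + 1) = μ j * (1 + δ * h j / ‖x j‖) := chainWeight_succ_of_mem hv
        have h3 : μ (j + 1) ≠ 0 := (zero_lt_one.trans_le (hμ1 (j + 1) hj)).ne'
        have h4 : μ (j + 1) - μ j = μ (j + 1) * h j * (μ j / μ (j + 1) * δ * ‖x j‖⁻¹) := by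
          calc _ = μ j * (δ * h j / ‖x j‖) := by rw [h2]; ring
            _ = _ := by field_simp
        simp only [hc, hp, if_pos hv]
        rw [h4, smul_add, mul_smul (μ (j + 1) * h j) (μ j / μ (j + 1) * δ * ‖x j‖⁻¹)]
      rw [h1]
      refine smul_mem_coneOf (hR _ hv _ ?_)
        (mul_nonneg (zero_le_one.trans (hμ1 (j + 1) hj)) (H.nonneg j hj))
      have h5 : 0 < μ j := zero_lt_one.trans_le (hμ1 j hj.le)
      have h6 : 0 < μ (j + 1) := zero_lt_one.trans_le (hμ1 (j + 1) hj)
      have h7 : μ j ≤ μ (j + 1) := by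
        rw [hμ, chainWeight_succ_of_mem hv]
        refine le_mul_of_one_le_right h5.le ?_
        have := H.nonneg j hj
        have : 0 ≤ δ * h j / ‖x j‖ := by positivity
        linarith
      rw [norm_smul, Real.norm_of_nonneg (by positivity)]
      have h8 : ‖x j‖⁻¹ * ‖x j‖ ≤ 1 := inv_mul_le_one
      have h9 : μ j / μ (j + 1) ≤ 1 := (div_le_one h6).2 h7
      calc μ j / μ (j + 1) * δ * ‖x j‖⁻¹ * ‖x j‖
          = (μ j / μ (j + 1)) * (‖x j‖⁻¹ * ‖x j‖) * δ := by ring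
        _ ≤ 1 * 1 * δ := by gcongr
        _ = δ := by ring
    · have h1 : c j = 0 := by
        simp only [hc, hp, if_neg hv, hμ, chainWeight_succ_of_notMem hv]
        simp
      rw [h1]
      exact zero_mem_coneOf _ _
  have hX : ∀ k ≤ m, μ k • x k =
      x 0 + ∑ j ∈ Finset.range k, c j + ∑ j ∈ Finset.range k, r j := by
    intro k hk
    induction k with
    | zero => simp [hμ0]
    | succ k ih =>
      have h1 : μ (k + 1) • x (k + 1) = μ k • x k + c k + r k := by
        rw [H.step k hk, ← hpq k]
        simp only [hc, hr]
        module
      rw [h1, ih (by omega), Finset.sum_range_succ, Finset.sum_range_succ]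
      abel
  obtain ⟨K, hK, hmax⟩ := Finset.exists_max_image (Finset.range (m + 1)) (fun k => μ k * ‖x k‖)
    ⟨0, by simp⟩
  simp only [Finset.mem_range, Nat.lt_succ_iff] at hK hmax
  set M := μ K * ‖x K‖ with hM
  have hM0 : 0 ≤ M := mul_nonneg (zero_le_one.trans (hμ1 K hK)) (norm_nonneg _)
  set ε' := 2 * ε * (1 + ρ) with hε'
  have hε'0 : 0 ≤ ε' := by positivity
  have hnear : ∀ k ≤ m, ‖μ k • (y (k - 1) - x k)‖ ≤ ε' * (μ k * ‖x k‖) := by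
    intro k hk
    have h1 : 0 ≤ μ k := zero_le_one.trans (hμ1 k hk)
    rw [norm_smul, Real.norm_of_nonneg h1]
    calc μ k * ‖y (k - 1) - x k‖ ≤ μ k * (ε' * ‖x k‖) :=
          mul_le_mul_of_nonneg_left (H.norm_sub_pred_le hm hε hρ1 hρ hερ hk) h1
      _ = _ := by ring
  -- The comparison path stays at the vertex, where every direction is active and the increments `-c
  -- k` are admissible. The inputs differ by `x 0 + μ k • (y (k - 1) - x k)`.
  have hmain := hℓ m (fun k => μ k • y (k - 1)) (fun k => ∑ j ∈ Finset.range k, r j)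
    (fun _ => 0) (fun k => -∑ j ∈ Finset.range k, c j) (‖x 0‖ + ε' * M)
    (fun k hk => smul_mem_polyCone (H.mem _ (by omega)) (zero_le_one.trans (hμ1 k hk)))
    (fun k _ i => by simp) (by simp) (by simp)
    (fun k hk => by
      have h1 : 0 < μ (k + 1) := zero_lt_one.trans_le (hμ1 (k + 1) hk)
      rw [Finset.sum_range_succ_sub_sum, Nat.add_sub_cancel, activeSet_smul nor _ h1]
      refine smul_mem_coneOf ?_ (mul_nonneg h1.le (H.nonneg k hk))
      by_cases hv : v k ∈ R
      · simp only [hq, if_pos hv]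
        exact zero_mem_coneOf _ _
      · simp only [hq, if_neg hv]
        exact ((H.velocity k hk).resolve_left hv).1)
    (fun k hk => by
      have h1 : -∑ j ∈ Finset.range (k + 1), c j - -∑ j ∈ Finset.range k, c j = -c k := by
        rw [Finset.sum_range_succ]
        abel
      rw [h1]
      exact neg_mem_coneOf_of_mem_stabilityCone (hcC k hk))
    (fun k hk => by
      have h1 : μ k • y (k - 1) - ∑ j ∈ Finset.range k, r j -
          (0 - -∑ j ∈ Finset.range k, c j) = x 0 + μ k • (y (k - 1) - x k) := by
        rw [smul_sub, hX k hk]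
        abel
      rw [h1]
      refine (norm_add_le _ _).trans (add_le_add_right ((hnear k hk).trans ?_) _)
      exact mul_le_mul_of_nonneg_left (hmax k hk) hε'0)
    K hK
  have h1 : M ≤ ‖μ K • y (K - 1)‖ + ε' * M := by
    have h2 : μ K • x K = μ K • y (K - 1) - μ K • (y (K - 1) - x K) := by
      rw [smul_sub]
      abel
    have h3 : M = ‖μ K • x K‖ := by
      rw [norm_smul, Real.norm_of_nonneg (zero_le_one.trans (hμ1 K hK))]
    rw [h3, h2]
    refine (norm_sub_le _ _).trans (add_le_add_right ((hnear K hK).trans_eq ?_) _)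
    rw [← h2, ← h3]
  simp only [sub_zero] at hmain
  refine (hmax k hk).trans ?_
  -- From `M ≤ ℓ * (‖x 0‖ + ε' * M) + ε' * M` and `ε' * (1 + ℓ) ≤ 1 / 2`, the terms in `M` are
  -- absorbed.
  nlinarith

theorem IsChain.norm_le (H : IsChain nor dir R ε m x y v h) (hδ : 0 ≤ δ) {B : ℝ}
    (hB : ∀ k ≤ m, chainWeight R δ x v h k * ‖x k‖ ≤ B) {k : ℕ} (hk : k ≤ m) : ‖x k‖ ≤ B :=
  (le_mul_of_one_le_left (norm_nonneg _) (H.one_le_chainWeight hδ hk)).trans (hB k hk)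

-- A drift step satisfies `δ * h k = a * ‖x k‖ ≤ a * B / μ`, where the weight `μ` grows by the
-- factor `1 + a`. This is at most `2 * B` times the drop of the inverse weight, and these drops
-- telescope.
open Classical in
theorem IsChain.sum_velocity_le (H : IsChain nor dir R ε m x y v h) (hδ : 0 ≤ δ)
    (hδε : δ * ε ≤ 1) {B : ℝ} (hB : ∀ k ≤ m, chainWeight R δ x v h k * ‖x k‖ ≤ B) :
    δ * ∑ j ∈ Finset.range m, (if v j ∈ R then h j else 0) ≤ 2 * B := by
  have hB0 : 0 ≤ B := (norm_nonneg _).trans (H.norm_le hδ hB (zero_le : 0 ≤ m))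
  have key : ∀ k ≤ m, δ * ∑ j ∈ Finset.range k, (if v j ∈ R then h j else 0) ≤
      2 * B * (1 - (chainWeight R δ x v h k)⁻¹) := by
    intro k hk
    induction k with
    | zero => simp [chainWeight]
    | succ k ih =>
      have h1 := ih (by omega)
      rw [Finset.sum_range_succ]
      by_cases hv : v k ∈ R
      · have hμ := H.one_le_chainWeight hδ (k := k) (by omega)
        have hh := H.nonneg k hk
        rw [chainWeight_succ_of_mem hv, if_pos hv]
        have hBk := hB k (by omega)
        have hs := H.small k hk
        generalize chainWeight R δ x v h k = μ at *
        have hμ0 : 0 < μ := by linarith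
        rcases (norm_nonneg (x k)).eq_or_lt with h0 | h0
        -- At the vertex the smallness condition forces a step of length zero.
        · rw [← h0] at hs ⊢
          have : h k = 0 := by linarith
          simpa [this] using h1
        · set a := δ * h k / ‖x k‖ with ha
          have ha0 : 0 ≤ a := by positivity
          have ha1 : a ≤ 1 := by
            rw [ha, div_le_one h0]
            nlinarith
          have hak : δ * h k = a * ‖x k‖ := by rw [ha, div_mul_cancel₀ _ h0.ne']
          have h2 : ‖x k‖ ≤ B / μ := by rw [le_div_iff₀ hμ0]; linarith
          have h3 : μ⁻¹ - (μ * (1 + a))⁻¹ = μ⁻¹ * (a / (1 + a)) := by field_simp; ring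
          have h4 : a / 2 ≤ a / (1 + a) := by gcongr; linarith
          have h5 : a * (B / μ) ≤ 2 * B * (μ⁻¹ - (μ * (1 + a))⁻¹) := by
            rw [h3]
            calc a * (B / μ) = 2 * B * (μ⁻¹ * (a / 2)) := by ring
              _ ≤ _ := by gcongr
          have h6 : a * ‖x k‖ ≤ a * (B / μ) := mul_le_mul_of_nonneg_left h2 ha0
          rw [mul_add, hak]
          linarith
      · rwa [chainWeight_succ_of_notMem hv, if_neg hv, add_zero]
  refine (key m le_rfl).trans ?_
  have := inv_nonneg.2 (zero_le_one.trans (H.one_le_chainWeight hδ (le_refl m)))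
  nlinarith

-- Along the chain, `⟪w, x k⟫` gains at least `c * h k` in a reflection step and loses at most `‖w‖
-- * ρ * h k` in a drift step.
open Classical in
theorem IsChain.sum_reflection_le (H : IsChain nor dir R ε m x y v h)
    (hρ : ∀ r ∈ R, ‖r‖ ≤ ρ) {w : EuclideanSpace ℝ (Fin n)} {c : ℝ}
    (hw : ∀ z, ∀ d ∈ constraintField nor dir z, c ≤ ⟪w, d⟫) :
    c * ∑ j ∈ Finset.range m, (if v j ∈ R then 0 else h j) ≤
      ‖w‖ * (‖x m‖ + ‖x 0‖) +
        ‖w‖ * ρ * ∑ j ∈ Finset.range m, (if v j ∈ R then h j else 0) := by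
  have key : ∀ k ≤ m, c * ∑ j ∈ Finset.range k, (if v j ∈ R then 0 else h j) ≤
      ⟪w, x k - x 0⟫ + ‖w‖ * ρ * ∑ j ∈ Finset.range k, (if v j ∈ R then h j else 0) := by
    intro k hk
    induction k with
    | zero => simp
    | succ k ih =>
      have h1 := ih (by omega)
      have hh := H.nonneg k hk
      rw [Finset.sum_range_succ, Finset.sum_range_succ, H.step k hk, add_sub_right_comm,
        inner_add_right, real_inner_smul_right]
      split_ifs with hv
      · have h2 := neg_le_of_abs_le (abs_real_inner_le_norm w (v k))
        have h3 := mul_le_mul_of_nonneg_left (hρ _ hv) (norm_nonneg w)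
        nlinarith
      · have := hw _ _ ((H.velocity k hk).resolve_left hv)
        nlinarith
  refine (key m le_rfl).trans (add_le_add_left ?_ _)
  exact (real_inner_le_norm _ _).trans
    (mul_le_mul_of_nonneg_left (norm_sub_le _ _) (norm_nonneg _))

end

/-- The total duration of an approximate trajectory is bounded by a multiple of the distance of its
starting point from the vertex. -/
theorem exists_chain_bound {n N : ℕ} {nor dir : Fin N → EuclideanSpace ℝ (Fin n)}
    (hnor : ∀ i, ‖nor i‖ = 1) (hdir : ∀ i, ‖dir i‖ = 1) (hS : CompletelyS nor dir)
    (hreg : SkorohodRegular nor dir) {R : Set (EuclideanSpace ℝ (Fin n))} (hR : IsCompact R)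
    (hsub : R ⊆ interior (stabilityCone dir)) :
    ∃ ε T : ℝ, 0 < ε ∧ 1 ≤ T ∧ ∀ (m : ℕ) (x y v : ℕ → EuclideanSpace ℝ (Fin n)) (h : ℕ → ℝ),
      IsChain nor dir R ε m x y v h →
        ∑ j ∈ Finset.range m, h j + ‖x m‖ ≤ T * ‖x 0‖ := by
  classical
  obtain ⟨ℓ, hℓ0, hℓ⟩ := exists_discrete_lipschitz hnor hreg
  obtain ⟨w, c, hc, hw⟩ := hS.exists_inner_pos
  obtain ⟨δ, hδ, hδR⟩ := hR.exists_cthickening_subset_open isOpen_interior hsub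
  obtain ⟨ρ', hρ'⟩ := hR.isBounded.exists_norm_le
  set ρ := max 1 ρ' with hρdef
  have hρ1 : 1 ≤ ρ := le_max_left _ _
  have hρ : ∀ r ∈ R, ‖r‖ ≤ ρ := fun r hr => (hρ' r hr).trans (le_max_right _ _)
  have hRC : ∀ r ∈ R, ∀ u, ‖u‖ ≤ δ → r + u ∈ stabilityCone dir := fun r hr u hu =>
    interior_subset (hδR (Metric.mem_cthickening_of_dist_le _ r _ _ hr (by simpa using hu)))
  -- The first bound keeps each weight factor at most `2`; the second makes the relative error small
  -- enough to be absorbed in `IsChain.weighted_norm_le`.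
  set ε := min δ⁻¹ (1 / (4 * (1 + ρ) * (1 + ℓ))) with hεdef
  have hε : 0 < ε := lt_min (by positivity) (by positivity)
  have hε1 : δ * ε ≤ 1 := by
    calc δ * ε ≤ δ * δ⁻¹ := mul_le_mul_of_nonneg_left (min_le_left _ _) hδ.le
      _ = 1 := mul_inv_cancel₀ hδ.ne'
  have hε2 : 2 * ε * (1 + ρ) * (1 + ℓ) ≤ 1 / 2 := by
    have h1 : ε ≤ 1 / (4 * (1 + ρ) * (1 + ℓ)) := min_le_right _ _
    rw [le_div_iff₀ (by positivity)] at h1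
    linarith
  have hε3 : ε * ρ ≤ 1 / 2 := by
    have : 0 ≤ ε * (1 + ρ) * ℓ := by positivity
    nlinarith
  set A := 2 * (2 * ℓ) / δ with hA
  set S := (‖w‖ * (2 * ℓ + 1) + ‖w‖ * ρ * A) / c with hSdef
  have hA0 : 0 ≤ A := by positivity
  have hS0 : 0 ≤ S := by positivity
  refine ⟨ε, 1 + (A + S + 2 * ℓ), hε, by linarith, fun m x y v h H => ?_⟩
  rcases Nat.eq_zero_or_pos m with rfl | hm
  · simp only [Finset.range_zero, Finset.sum_empty, zero_add]
    exact le_mul_of_one_le_left (norm_nonneg _) (by linarith)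
  have hB := fun k (hk : k ≤ m) =>
    H.weighted_norm_le hm hε.le hρ1 hρ hε3 hδ.le hRC hℓ hε2 hk
  have h1 := H.norm_le hδ.le hB le_rfl
  have h2 := H.sum_velocity_le hδ.le hε1 hB
  have h3 := H.sum_reflection_le hρ fun z d hd => le_inner_of_mem_constraintField hdir hc hw hd
  have h4 : ∑ j ∈ Finset.range m, h j = ∑ j ∈ Finset.range m, (if v j ∈ R then h j else 0) +
      ∑ j ∈ Finset.range m, (if v j ∈ R then 0 else h j) := by
    rw [← Finset.sum_add_distrib]
    exact Finset.sum_congr rfl fun j _ => by split_ifs <;> simp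
  set a := ∑ j ∈ Finset.range m, (if v j ∈ R then h j else 0)
  set b := ∑ j ∈ Finset.range m, (if v j ∈ R then 0 else h j)
  have h5 : a ≤ A * ‖x 0‖ := by
    rw [hA, div_mul_eq_mul_div, le_div_iff₀ hδ]
    linarith
  have h6 : b ≤ S * ‖x 0‖ := by
    rw [hSdef, div_mul_eq_mul_div, le_div_iff₀ hc]
    have h7 : ‖w‖ * ‖x m‖ ≤ ‖w‖ * (2 * ℓ * ‖x 0‖) := by gcongr
    have h8 : ‖w‖ * ρ * a ≤ ‖w‖ * ρ * (A * ‖x 0‖) := by gcongr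
    linarith
  rw [h4]
  nlinarith [norm_nonneg (x 0)]

/-! ### The value function -/

/-- `ReachesTime nor dir R ε x t`: some approximate trajectory from `x` has duration plus distance
of its end point from the vertex larger than `t`. -/
inductive ReachesTime {n N : ℕ} (nor dir : Fin N → EuclideanSpace ℝ (Fin n))
    (R : Set (EuclideanSpace ℝ (Fin n))) (ε : ℝ) : EuclideanSpace ℝ (Fin n) → ℝ → Prop
  | halt {x : EuclideanSpace ℝ (Fin n)} {t : ℝ} : t < ‖x‖ → ReachesTime nor dir R ε x t
  | step {x y v : EuclideanSpace ℝ (Fin n)} {h t : ℝ} : y ∈ polyCone nor → ‖y - x‖ < ε * ‖x‖ →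
      0 ≤ h → h < ε * ‖x‖ → v ∈ R ∨ v ∈ constraintField nor dir y →
      ReachesTime nor dir R ε (x + h • v) t → ReachesTime nor dir R ε x (t + h)

section

variable {n N : ℕ} {nor dir : Fin N → EuclideanSpace ℝ (Fin n)}
  {R : Set (EuclideanSpace ℝ (Fin n))} {ε : ℝ}

theorem ReachesTime.exists_chain {x : EuclideanSpace ℝ (Fin n)} {t : ℝ}
    (H : ReachesTime nor dir R ε x t) :
    ∃ (m : ℕ) (x' y v : ℕ → EuclideanSpace ℝ (Fin n)) (h : ℕ → ℝ),
      IsChain nor dir R ε m x' y v h ∧ x' 0 = x ∧ t ≤ ∑ j ∈ Finset.range m, h j + ‖x' m‖ := by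
  induction H with
  | @halt x t ht =>
    exact ⟨0, fun _ => x, fun _ => 0, fun _ => 0, fun _ => 0,
      ⟨by simp, by simp, by simp, by simp, by simp, by simp⟩, rfl, by simpa using ht.le⟩
  | @step x y v h t hy hyx h0 hh hv _ ih =>
    obtain ⟨m, x', y', v', h', H, hx', ht⟩ := ih
    refine ⟨m + 1, fun k => Nat.casesOn k x x', fun k => Nat.casesOn k y y',
      fun k => Nat.casesOn k v v', fun k => Nat.casesOn k h h', ⟨?_, ?_, ?_, ?_, ?_, ?_⟩, rfl, ?_⟩
    · rintro (_ | k) hk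
      exacts [hy, H.mem k (by omega)]
    · rintro (_ | k) hk
      exacts [hyx.le, H.near k (by omega)]
    · rintro (_ | k) hk
      exacts [h0, H.nonneg k (by omega)]
    · rintro (_ | k) hk
      exacts [hh.le, H.small k (by omega)]
    · rintro (_ | k) hk
      exacts [hv, H.velocity k (by omega)]
    · rintro (_ | k) hk
      exacts [hx', H.step k (by omega)]
    · rw [Finset.sum_range_succ']
      change t + h ≤ ∑ j ∈ Finset.range m, h' j + h + ‖x' m‖
      linarith

/-- All conditions involving the starting point are strict inequalities, so the same `y`, `v`, `h`
serve nearby points. This makes the value function lower semicontinuous, hence measurable. -/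
theorem ReachesTime.eventually {x : EuclideanSpace ℝ (Fin n)} {t : ℝ}
    (H : ReachesTime nor dir R ε x t) : ∀ᶠ z in 𝓝 x, ReachesTime nor dir R ε z t := by
  induction H with
  | @halt x t ht =>
    filter_upwards [continuous_norm.continuousAt.eventually (lt_mem_nhds ht)] with z hz
    exact .halt hz
  | @step x y v h t hy hyx h0 hh hv _ ih =>
    have h1 : ∀ᶠ z in 𝓝 x, ‖y - z‖ < ε * ‖z‖ :=
      ContinuousAt.eventually_lt (by fun_prop) (by fun_prop) hyx
    have h2 : ∀ᶠ z in 𝓝 x, h < ε * ‖z‖ :=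
      ContinuousAt.eventually_lt (by fun_prop) (by fun_prop) hh
    have h3 : Tendsto (fun z => z + h • v) (𝓝 x) (𝓝 (x + h • v)) :=
      Continuous.tendsto (by fun_prop) x
    filter_upwards [h1, h2, h3.eventually ih] with z h1 h2 h3
    exact .step hy h1 h0 h2 hv h3

end

/-- A measurable function that is comparable to the norm and decreases at unit speed along all
mean velocities and along the constraint directions at nearby points. -/
theorem exists_decreasing_function {n N : ℕ} {nor dir : Fin N → EuclideanSpace ℝ (Fin n)}
    (hnor : ∀ i, ‖nor i‖ = 1) (hdir : ∀ i, ‖dir i‖ = 1) (hS : CompletelyS nor dir)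
    (hreg : SkorohodRegular nor dir) {R : Set (EuclideanSpace ℝ (Fin n))} (hR : IsCompact R)
    (hsub : R ⊆ interior (stabilityCone dir)) :
    ∃ (ε T : ℝ) (V : EuclideanSpace ℝ (Fin n) → ℝ), 0 < ε ∧ 1 ≤ T ∧ Measurable V ∧
      (∀ x, ‖x‖ ≤ V x) ∧ (∀ x, V x ≤ T * ‖x‖) ∧
      ∀ x y v h, y ∈ polyCone nor → ‖y - x‖ < ε * ‖x‖ → 0 ≤ h → h < ε * ‖x‖ →
        v ∈ R ∪ constraintField nor dir y → V (x + h • v) ≤ V x - h := by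
  obtain ⟨ε, T, hε, hT, hb⟩ := exists_chain_bound hnor hdir hS hreg hR hsub
  have hbd : ∀ x t, ReachesTime nor dir R ε x t → t ≤ T * ‖x‖ := by
    intro x t H
    obtain ⟨m, x', y, v, h, hc, rfl, ht⟩ := H.exists_chain
    exact ht.trans (hb _ _ _ _ _ hc)
  have hne : ∀ x, {t | ReachesTime nor dir R ε x t}.Nonempty := fun x =>
    ⟨‖x‖ - 1, .halt (by linarith)⟩
  have hbdd : ∀ x, BddAbove {t | ReachesTime nor dir R ε x t} := fun x => ⟨_, hbd x⟩
  refine ⟨ε, T, fun x => sSup {t | ReachesTime nor dir R ε x t}, hε, hT, ?_, fun x => ?_,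
    fun x => csSup_le (hne x) (hbd x), fun x y v h hy hyx h0 hh hv => ?_⟩
  · refine LowerSemicontinuous.measurable fun x a ha => ?_
    obtain ⟨t, ht, hat⟩ := exists_lt_of_lt_csSup (hne x) ha
    filter_upwards [ht.eventually] with z hz
    exact hat.trans_le (le_csSup (hbdd z) hz)
  · exact le_of_forall_lt fun t ht =>
      let ⟨s, hs, hs'⟩ := exists_between ht
      hs.trans_le (le_csSup (hbdd x) (.halt hs'))
  · refine csSup_le (hne _) fun t ht => ?_
    have := le_csSup (hbdd x) (ReachesTime.step hy hyx h0 hh hv ht)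
    linarith

/-! ### Truncation and mollification -/

theorem HasFDerivAt.apply_le_neg {E : Type*} [NormedAddCommGroup E] [NormedSpace ℝ E]
    {g : E → ℝ} {g' : E →L[ℝ] ℝ} {y v : E} (hg : HasFDerivAt g g' y) {κ h₀ : ℝ} (h₀pos : 0 < h₀)
    (h : ∀ t, 0 < t → t < h₀ → g (y + t • v) ≤ g y - κ * t) : g' v ≤ -κ := by
  have h1 : HasDerivAt (fun t : ℝ => g (y + t • v)) (g' v) 0 := by
    have h2 : HasDerivAt (fun t : ℝ => y + t • v) v 0 := by
      simpa using ((hasDerivAt_id (0 : ℝ)).smul_const v).const_add y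
    exact HasFDerivAt.comp_hasDerivAt (0 : ℝ) (by simpa using hg) h2
  refine le_of_tendsto h1.tendsto_slope_zero_right ?_
  filter_upwards [Ioo_mem_nhdsGT h₀pos] with t ht
  have h3 := h t ht.1 ht.2
  simp only [zero_add, zero_smul, add_zero, smul_eq_mul]
  rw [inv_mul_le_iff₀ ht.1]
  linarith

section Mollification

variable {E : Type*} [NormedAddCommGroup E] [InnerProductSpace ℝ E] [FiniteDimensional ℝ E]
  [MeasurableSpace E] [BorelSpace E]

theorem integrable_normed_mul {B : E → ℝ} (hB : Measurable B) {b : ℝ}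
    (hb : ∀ x, ‖B x‖ ≤ b) (θ : ContDiffBump (0 : E)) (y : E) :
    Integrable fun z => θ.normed volume z * B (y - z) := by
  refine θ.integrable_normed.mul_bdd (c := b) ?_ (ae_of_all _ fun z => hb _)
  exact (hB.comp (measurable_const.sub measurable_id)).aestronglyMeasurable

/-- Smoothing of a function that is bounded by multiples of the norm from both sides and decreases
along a field of directions. -/
theorem exists_smooth_decreasing {V : E → ℝ} (hV : Measurable V) {ε T : ℝ} (hε : 0 < ε)
    (hT : 1 ≤ T) (hlow : ∀ x, ‖x‖ ≤ V x) (hup : ∀ x, V x ≤ T * ‖x‖) {G : Set E} {F : E → Set E}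
    (hF : ∀ x y v h, y ∈ G → ‖y - x‖ < ε * ‖x‖ → 0 ≤ h → h < ε * ‖x‖ → v ∈ F y →
      V (x + h • v) ≤ V x - h) :
    ∃ (g : E → ℝ) (r₀ r₁ b : ℝ), ContDiff ℝ 3 g ∧ 0 < r₀ ∧ r₀ ≤ 1 ∧ 4 ≤ r₁ ∧ 1 < b ∧
      (∀ x, ‖x‖ ≤ r₀ → g x = 1) ∧ (∀ x, r₁ ≤ ‖x‖ → g x = b) ∧ (∀ x, 1 ≤ g x) ∧
      (∀ y ∈ G, ∀ v ∈ F y, fderiv ℝ g y v ≤ 0) ∧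
      ∀ y ∈ G, 2 ≤ ‖y‖ → ‖y‖ ≤ 3 → ∀ v ∈ F y, fderiv ℝ g y v ≤ -1 := by
  have hT0 : 0 < T := zero_lt_one.trans_le hT
  -- Since `V x ≤ T * ‖x‖`, this upper truncation is inactive for `‖x‖ ≤ 4`, a range covering the
  -- shell `2 ≤ ‖y‖ ≤ 3` with its mollification margin.
  set b := 4 * T with hb
  have hb1 : 1 < b := by linarith
  set B : E → ℝ := fun x => max 1 (min (V x) b) with hBdef
  have hBm : Measurable B := measurable_const.max (hV.min measurable_const)
  have hB1 : ∀ x, 1 ≤ B x := fun x => le_max_left _ _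
  have hBb : ∀ x, ‖B x‖ ≤ b := fun x => by
    rw [Real.norm_of_nonneg (zero_le_one.trans (hB1 x))]
    exact max_le hb1.le (min_le_right _ _)
  have hBlow : ∀ x, ‖x‖ ≤ T⁻¹ → B x = 1 := fun x hx => by
    refine max_eq_left ((min_le_left _ _).trans ((hup x).trans ?_))
    calc T * ‖x‖ ≤ T * T⁻¹ := mul_le_mul_of_nonneg_left hx hT0.le
      _ = 1 := mul_inv_cancel₀ hT0.ne'
  have hBup : ∀ x, b ≤ ‖x‖ → B x = b := fun x hx => by
    simp only [hBdef]
    rw [min_eq_right (hx.trans (hlow x)), max_eq_right hb1.le]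
  have hBmono : ∀ x z, V x ≤ V z → B x ≤ B z := fun x z h =>
    max_le_max le_rfl (min_le_min h le_rfl)
  have hBstrict : ∀ x z t, V x ≤ V z - t → 1 ≤ V z - t → V z ≤ b → B x ≤ B z - t := by
    intro x z t h1 h2 h3
    simp only [hBdef]
    rw [min_eq_left h3]
    refine (max_le h2 ((min_le_left _ _).trans h1)).trans ?_
    linarith [le_max_right 1 (V z)]
  set τ := T⁻¹ with hτ
  have hτ0 : 0 < τ := inv_pos.2 hT0
  have hτ1 : τ ≤ 1 := inv_le_one_of_one_le₀ hT
  -- With this radius, every `y` with `‖y‖ ≥ τ / 2` is within the relative tolerance `ε` of each `y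
  -- - z` in the averaging, so directions in `F y` decrease `V` there.
  set η := min (τ / 4) (ε * (τ / 4)) with hη
  have hη0 : 0 < η := lt_min (by positivity) (by positivity)
  have hη1 : η ≤ τ / 4 := min_le_left _ _
  have hη2 : η ≤ ε * (τ / 4) := min_le_right _ _
  let θ : ContDiffBump (0 : E) := ⟨η / 2, η, by positivity, by linarith⟩
  set g : E → ℝ := convolution (θ.normed volume) B (ContinuousLinearMap.lsmul ℝ ℝ) volume with hg
  have hgval : ∀ y, g y = ∫ z, θ.normed volume z * B (y - z) := fun y => by
    rw [hg, convolution_lsmul]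
    rfl
  have hgsm : ContDiff ℝ 3 g := by
    refine HasCompactSupport.contDiff_convolution_left (n := 3) _ θ.hasCompactSupport_normed
      θ.contDiff_normed ?_
    refine (memLp_top_of_bound hBm.aestronglyMeasurable b (ae_of_all _ hBb)).locallyIntegrable ?_
    simp
  have hder : ∀ (y v : E) (κ h₀ : ℝ), 0 < h₀ →
      (∀ z t, ‖z‖ < η → 0 < t → t < h₀ → B (y - z + t • v) ≤ B (y - z) - κ * t) →
      fderiv ℝ g y v ≤ -κ := by
    intro y v κ h₀ hh₀ H
    refine HasFDerivAt.apply_le_neg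
      (hgsm.differentiable (by norm_num) y).hasFDerivAt hh₀ fun t ht ht' => ?_
    have h1 : g y - κ * t = ∫ z, θ.normed volume z * (B (y - z) - κ * t) := by
      simp only [mul_sub]
      rw [integral_sub (integrable_normed_mul hBm hBb θ y) (θ.integrable_normed.mul_const _),
        integral_mul_const, θ.integral_normed, one_mul, hgval]
    rw [h1, hgval]
    refine integral_mono (integrable_normed_mul hBm hBb θ _) ?_ fun z => ?_
    · simp only [mul_sub]
      exact (integrable_normed_mul hBm hBb θ y).sub (θ.integrable_normed.mul_const _)
    · by_cases hz : ‖z‖ < η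
      · refine mul_le_mul_of_nonneg_left ?_ (θ.nonneg_normed z)
        rw [add_sub_right_comm]
        exact H z t hz ht ht'
      · have : θ.normed volume z = 0 := by
          rw [← Function.notMem_support, θ.support_normed_eq]
          simpa using hz
        simp [this]
  have hclose : ∀ y z : E, τ / 2 ≤ ‖y‖ → ‖z‖ < η → τ / 4 ≤ ‖y - z‖ ∧
      ‖y - (y - z)‖ < ε * ‖y - z‖ := by
    intro y z hy hz
    have h1 := norm_sub_norm_le y z
    have h2 : τ / 4 ≤ ‖y - z‖ := by linarith
    refine ⟨h2, ?_⟩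
    rw [sub_sub_cancel]
    exact hz.trans_le (hη2.trans (mul_le_mul_of_nonneg_left h2 hε.le))
  refine ⟨g, τ / 2, b + 1, b, hgsm, by positivity, by linarith, by linarith, hb1, fun x hx => ?_,
    fun x hx => ?_, fun x => ?_, fun y hy v hv => ?_, fun y hy hy2 hy3 v hv => ?_⟩
  · have hBx : B x = 1 := hBlow x (by linarith)
    rw [hg, θ.normed_convolution_eq_right, hBx]
    intro z hz
    have hz' : ‖z - x‖ < η := mem_ball_iff_norm.1 hz
    have := norm_sub_norm_le z x
    rw [hBx, hBlow z (by linarith)]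
  · have hBx : B x = b := hBup x (by linarith)
    rw [hg, θ.normed_convolution_eq_right, hBx]
    intro z hz
    have hz' : ‖x - z‖ < η := mem_ball_iff_norm'.1 hz
    have := norm_sub_norm_le x z
    rw [hBx, hBup z (by linarith)]
  · rw [hgval, ← θ.integral_normed (μ := volume)]
    exact integral_mono θ.integrable_normed (integrable_normed_mul hBm hBb θ x) fun z =>
      le_mul_of_one_le_right (θ.nonneg_normed z) (hB1 _)
  · rw [← neg_zero]
    -- Near the origin the relative tolerance cannot be met, but there `B` is constantly one.
    rcases lt_or_ge ‖y‖ (τ / 2) with hys | hys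
    · refine hder y v 0 (τ / 4 / (1 + ‖v‖)) (by positivity) fun z t hz ht ht' => ?_
      rw [lt_div_iff₀ (by positivity)] at ht'
      have h1 := norm_sub_le y z
      have h2 : ‖y - z + t • v‖ ≤ ‖y - z‖ + t * ‖v‖ := by
        refine (norm_add_le _ _).trans_eq ?_
        rw [norm_smul, Real.norm_of_nonneg ht.le]
      rw [hBlow _ (by linarith), hBlow _ (by linarith)]
      simp
    · refine hder y v 0 (ε * (τ / 4)) (by positivity) fun z t hz ht ht' => ?_
      obtain ⟨h1, h2⟩ := hclose y z hys hz
      have := hF (y - z) y v t hy h2 ht.le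
        (ht'.trans_le (mul_le_mul_of_nonneg_left h1 hε.le)) hv
      rw [zero_mul, sub_zero]
      exact hBmono _ _ (by linarith)
  · refine hder y v 1 (min (ε * (τ / 4)) (1 / 2)) (by positivity) fun z t hz ht ht' => ?_
    obtain ⟨h1, h2⟩ := hclose y z (by linarith) hz
    have h3 := norm_sub_norm_le y z
    have h4 := norm_sub_le y z
    have ht2 := ht'.trans_le (min_le_right _ _)
    have h5 := hlow (y - z)
    have h6 : V (y - z) ≤ b := (hup _).trans (by
      rw [hb, mul_comm 4]
      exact mul_le_mul_of_nonneg_left (by linarith) hT0.le)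
    rw [one_mul]
    exact hBstrict _ _ _ (hF (y - z) y v t hy h2 ht.le
      ((ht'.trans_le (min_le_left _ _)).trans_le (mul_le_mul_of_nonneg_left h1 hε.le)) hv)
      (by linarith) h6

end Mollification

-- Homogenization by radial integration

universe u

section Parametric

variable {E F : Type u} [NormedAddCommGroup E] [NormedSpace ℝ E] [ProperSpace E]
  [NormedAddCommGroup F] [NormedSpace ℝ F]

theorem hasFDerivAt_integral_comp_smul {Φ : E → F} (hΦ : ContDiff ℝ 1 Φ) {w : ℝ → ℝ} {a b : ℝ}
    (hw : ContinuousOn w (uIcc a b)) (x₀ : E) :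
    HasFDerivAt (fun x => ∫ s in a..b, w s • Φ (s • x))
      (∫ s in a..b, (w s * s) • fderiv ℝ Φ (s • x₀)) x₀ := by
  have hΦc := hΦ.continuous
  have hdΦ : Continuous (fderiv ℝ Φ) := hΦ.continuous_fderiv one_ne_zero
  have hmeas : ∀ {H : Type u} [NormedAddCommGroup H] [NormedSpace ℝ H] (p : ℝ → H),
      ContinuousOn p (uIcc a b) → IntervalIntegrable p volume a b := fun p hp =>
    hp.intervalIntegrable
  have h0 : ∀ x, ContinuousOn (fun s => w s • Φ (s • x)) (uIcc a b) := fun x =>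
    hw.smul (by fun_prop)
  have h1 : ContinuousOn (fun s => (w s * s) • fderiv ℝ Φ (s • x₀)) (uIcc a b) :=
    (hw.mul continuousOn_id).smul (by fun_prop)
  have hcomp : IsCompact (uIcc a b ×ˢ Metric.closedBall x₀ 1) :=
    isCompact_uIcc.prod (isCompact_closedBall _ _)
  have hcont : ContinuousOn (fun p : ℝ × E => (w p.1 * p.1) • fderiv ℝ Φ (p.1 • p.2))
      (uIcc a b ×ˢ Metric.closedBall x₀ 1) := by
    refine ContinuousOn.smul ((hw.comp continuousOn_fst fun p hp => hp.1).mul continuousOn_fst) ?_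
    fun_prop
  obtain ⟨C, hC⟩ := hcomp.exists_bound_of_continuousOn hcont
  refine intervalIntegral.hasFDerivAt_integral_of_dominated_of_fderiv_le
    (F' := fun x s => (w s * s) • fderiv ℝ Φ (s • x)) (bound := fun _ => C)
    (Metric.ball_mem_nhds x₀ one_pos)
    (Eventually.of_forall fun x => (hmeas _ (h0 x)).def'.aestronglyMeasurable)
    (hmeas _ (h0 x₀)) (hmeas _ h1).def'.aestronglyMeasurable ?_ intervalIntegrable_const ?_
  · refine ae_of_all _ fun s hs x hx => ?_
    exact hC (s, x) ⟨uIoc_subset_uIcc hs, Metric.ball_subset_closedBall hx⟩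
  · refine ae_of_all _ fun s _ x _ => ?_
    have h2 : HasFDerivAt (fun x : E => s • x) (s • ContinuousLinearMap.id ℝ E) x :=
      (hasFDerivAt_id x).const_smul s
    have h3 := ((hΦ.differentiable one_ne_zero (s • x)).hasFDerivAt.comp x h2).const_smul (w s)
    have h4 : (w s * s) • fderiv ℝ Φ (s • x) =
        w s • (fderiv ℝ Φ (s • x)).comp (s • ContinuousLinearMap.id ℝ E) := by
      ext z
      simp [mul_smul]
    rw [h4]
    exact h3

/-- Differentiating under the integral gives an integral of the same form with weight `w s * s`. One
derivative is given up because the base case gets continuity from differentiability; hence `g` is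
taken `C³`. -/
theorem contDiff_integral_comp_smul {Φ : E → F} {k : ℕ} (hΦ : ContDiff ℝ (k + 1) Φ) {w : ℝ → ℝ}
    {a b : ℝ} (hw : ContinuousOn w (uIcc a b)) :
    ContDiff ℝ k (fun x => ∫ s in a..b, w s • Φ (s • x)) := by
  induction k generalizing F w with
  | zero =>
    refine contDiff_zero.2 (continuous_iff_continuousAt.2 fun x => ?_)
    exact (hasFDerivAt_integral_comp_smul (by simpa using hΦ) hw x).continuousAt
  | succ k ih =>
    rw [Nat.cast_succ]
    refine contDiff_succ_iff_hasFDerivAt.2 ⟨_, ?_, fun x =>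
      hasFDerivAt_integral_comp_smul (hΦ.of_le (by simp)) hw x⟩
    exact ih (hΦ.fderiv_right (by simp)) (hw.mul continuousOn_id)

end Parametric

section Homogeneous

variable {E F : Type*} [NormedAddCommGroup E] [NormedSpace ℝ E]
  [NormedAddCommGroup F] [NormedSpace ℝ F]

theorem fderiv_smul_of_homogeneous {f : E → ℝ}
    (hf : ∀ s : ℝ, 0 < s → ∀ x, f (s • x) = s * f x) {s : ℝ} (hs : 0 < s) (x : E) :
    fderiv ℝ f (s • x) = fderiv ℝ f x := by
  have h1 : (fun x => f (s • x)) = s • f := funext fun x => hf s hs x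
  have h2 := fderiv_comp_smul (𝕜 := ℝ) (f := f) (x := x) s
  rw [h1, fderiv_const_smul_field] at h2
  exact (smul_right_injective _ hs.ne' h2).symm

theorem fderiv_smul_of_invariant {f : E → F}
    (hf : ∀ s : ℝ, 0 < s → ∀ x, f (s • x) = f x) {s : ℝ} (hs : 0 < s) (x : E) :
    fderiv ℝ f (s • x) = s⁻¹ • fderiv ℝ f x := by
  have h1 : (fun x => f (s • x)) = f := funext fun x => hf s hs x
  have h2 := fderiv_comp_smul (𝕜 := ℝ) (f := f) (x := x) s
  rw [h1] at h2
  rw [h2, smul_smul, inv_mul_cancel₀ hs.ne', one_smul]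

end Homogeneous

/-- For all `x` near `x₀`, one interval `[p, q]` of scales contains every `s` at which `s • x` lies
in the region where `g` may vary. -/
theorem exists_radial_interval {E : Type*} [NormedAddCommGroup E] {r₀ r₁ : ℝ} (hr₀ : 0 < r₀)
    (hr₁ : r₀ ≤ r₁) {x₀ : E} (hx₀ : x₀ ≠ 0) :
    ∃ p q : ℝ, 0 < p ∧ p ≤ q ∧ p * ‖x₀‖ ≤ r₀ ∧ r₁ ≤ q * ‖x₀‖ ∧
      ∀ᶠ x in 𝓝 x₀, p * ‖x‖ ≤ r₀ ∧ r₁ ≤ q * ‖x‖ := by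
  have h0 : 0 < ‖x₀‖ := norm_pos_iff.2 hx₀
  have h1 : ∀ᶠ x in 𝓝 x₀, ‖x₀‖ / 2 < ‖x‖ ∧ ‖x‖ < 2 * ‖x₀‖ :=
    (continuous_norm.continuousAt.eventually (lt_mem_nhds (half_lt_self h0))).and
      (continuous_norm.continuousAt.eventually (gt_mem_nhds (by linarith)))
  have h2 : ∀ᶠ x in 𝓝 x₀, r₀ / (2 * ‖x₀‖) * ‖x‖ ≤ r₀ ∧ r₁ ≤ 2 * r₁ / ‖x₀‖ * ‖x‖ := by
    filter_upwards [h1] with x hx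
    constructor
    · rw [div_mul_eq_mul_div, div_le_iff₀ (by positivity)]
      exact mul_le_mul_of_nonneg_left hx.2.le hr₀.le
    · rw [div_mul_eq_mul_div, le_div_iff₀ h0]
      nlinarith [hx.1]
  refine ⟨r₀ / (2 * ‖x₀‖), 2 * r₁ / ‖x₀‖, by positivity, ?_, h2.self_of_nhds.1,
    h2.self_of_nhds.2, h2⟩
  rw [div_le_div_iff₀ (by positivity) h0]
  nlinarith

section RadialIntegral

variable {E : Type*} [NormedAddCommGroup E] [NormedSpace ℝ E]

/-- Superposition of all rescalings of `g - 1`, with weights that make it homogeneous of degree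
one. -/
noncomputable def radialIntegral (g : E → ℝ) (x : E) : ℝ :=
  ∫ s in Ioi (0 : ℝ), s ^ (-2 : ℝ) • (g (s • x) - 1)

theorem radialIntegral_smul (g : E → ℝ) {t : ℝ} (ht : 0 < t) (x : E) :
    radialIntegral g (t • x) = t * radialIntegral g x := by
  have h1 := integral_comp_mul_right_Ioi (fun s => s ^ (-2 : ℝ) • (g (s • x) - 1)) 0 ht
  rw [zero_mul] at h1
  have h2 : ∫ s in Ioi (0 : ℝ), (s * t) ^ (-2 : ℝ) • (g ((s * t) • x) - 1) =
      t ^ (-2 : ℝ) * radialIntegral g (t • x) := by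
    rw [radialIntegral, ← integral_const_mul]
    refine setIntegral_congr_fun measurableSet_Ioi fun s hs => ?_
    simp only [smul_eq_mul]
    rw [Real.mul_rpow (le_of_lt hs) ht.le, mul_smul]
    ring
  rw [h2, smul_eq_mul, Real.rpow_neg ht.le, ← radialIntegral] at h1
  have h3 : t ^ (2 : ℝ) = t ^ 2 := Real.rpow_two t
  rw [h3] at h1
  field_simp at h1
  exact h1

variable {g : E → ℝ} {r₀ r₁ b : ℝ}

/-- Away from the origin, the radial integral is locally an integral over a compact interval. -/
theorem radialIntegral_eq (hg : Continuous g) (hlow : ∀ x, ‖x‖ ≤ r₀ → g x = 1)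
    (hup : ∀ x, r₁ ≤ ‖x‖ → g x = b) {p q : ℝ} (hp : 0 < p) (hpq : p ≤ q) {x : E}
    (hpx : p * ‖x‖ ≤ r₀) (hqx : r₁ ≤ q * ‖x‖) :
    radialIntegral g x = (∫ s in p..q, s ^ (-2 : ℝ) • (g (s • x) - 1)) + q⁻¹ * (b - 1) := by
  have hq : 0 < q := hp.trans_le hpq
  set φ : ℝ → ℝ := fun s => s ^ (-2 : ℝ) • (g (s • x) - 1) with hφ
  have h1 : radialIntegral g x = ∫ s in Ioi p, φ s := by
    refine setIntegral_eq_of_subset_of_forall_sdiff_eq_zero measurableSet_Ioi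
      (Ioi_subset_Ioi hp.le) fun s hs => ?_
    have hs0 : 0 < s := hs.1
    have hsp : s ≤ p := not_lt.1 hs.2
    have : g (s • x) = 1 := hlow _ (by
      rw [norm_smul, Real.norm_of_nonneg hs0.le]
      exact (mul_le_mul_of_nonneg_right hsp (norm_nonneg _)).trans hpx)
    simp [this]
  have h2 : EqOn φ (fun s => s ^ (-2 : ℝ) * (b - 1)) (Ioi q) := by
    intro s hs
    have hs' : q < s := hs
    have : g (s • x) = b := hup _ (by
      rw [norm_smul, Real.norm_of_nonneg (hq.trans hs').le]
      exact hqx.trans (mul_le_mul_of_nonneg_right hs'.le (norm_nonneg _)))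
    simp [hφ, this]
  have h3 : IntegrableOn φ (Ioi q) :=
    IntegrableOn.congr_fun ((integrableOn_Ioi_rpow_of_lt (by norm_num) hq).mul_const (b - 1))
      h2.symm measurableSet_Ioi
  have h4 : IntervalIntegrable φ volume p q := by
    refine ContinuousOn.intervalIntegrable ?_
    rw [uIcc_of_le hpq]
    refine ContinuousOn.smul (f := fun s : ℝ => s ^ (-2 : ℝ)) ?_ (by fun_prop)
    exact continuousOn_id.rpow_const fun s hs => Or.inl (hp.trans_le hs.1).ne'
  rw [h1, ← intervalIntegral.integral_interval_add_Ioi' h4 h3, setIntegral_congr_fun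
    measurableSet_Ioi h2, integral_mul_const, integral_Ioi_rpow_of_lt (by norm_num) hq]
  congr 2
  norm_num [Real.rpow_neg_one]

theorem continuousOn_rpow_uIcc {p q : ℝ} (hp : 0 < p) (hpq : p ≤ q) (a : ℝ) :
    ContinuousOn (fun s : ℝ => s ^ a) (uIcc p q) := by
  rw [uIcc_of_le hpq]
  exact continuousOn_id.rpow_const fun s hs => Or.inl (hp.trans_le hs.1).ne'

theorem contDiffAt_radialIntegral {E : Type} [NormedAddCommGroup E] [NormedSpace ℝ E]
    [ProperSpace E] {g : E → ℝ} (hg : ContDiff ℝ 3 g) (hr₀ : 0 < r₀) (hr₁ : r₀ ≤ r₁)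
    (hlow : ∀ x, ‖x‖ ≤ r₀ → g x = 1) (hup : ∀ x, r₁ ≤ ‖x‖ → g x = b) {x₀ : E} (hx₀ : x₀ ≠ 0) :
    ContDiffAt ℝ 2 (radialIntegral g) x₀ := by
  obtain ⟨p, q, hp, hpq, -, -, hev⟩ := exists_radial_interval hr₀ hr₁ hx₀
  have h1 : radialIntegral g =ᶠ[𝓝 x₀] fun x =>
      (∫ s in p..q, s ^ (-2 : ℝ) • (g (s • x) - 1)) + q⁻¹ * (b - 1) := by
    filter_upwards [hev] with x hx
    exact radialIntegral_eq hg.continuous hlow hup hp hpq hx.1 hx.2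
  refine ContDiffAt.congr_of_eventuallyEq (ContDiff.contDiffAt ?_) h1
  refine ContDiff.add ?_ contDiff_const
  exact contDiff_integral_comp_smul (k := 2) (Φ := fun x => g x - 1)
    (by exact_mod_cast hg.sub contDiff_const) (continuousOn_rpow_uIcc hp hpq _)

theorem radialIntegral_pos (hg : Continuous g) (hr₀ : 0 < r₀) (hr₁ : r₀ ≤ r₁) (hb : 1 < b)
    (hlow : ∀ x, ‖x‖ ≤ r₀ → g x = 1) (hup : ∀ x, r₁ ≤ ‖x‖ → g x = b) (h1 : ∀ x, 1 ≤ g x)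
    {x : E} (hx : x ≠ 0) : 0 < radialIntegral g x := by
  obtain ⟨p, q, hp, hpq, hpx, hqx, -⟩ := exists_radial_interval hr₀ hr₁ hx
  rw [radialIntegral_eq hg hlow hup hp hpq hpx hqx]
  refine add_pos_of_nonneg_of_pos (intervalIntegral.integral_nonneg hpq fun s hs => ?_)
    (mul_pos (inv_pos.2 (hp.trans_le hpq)) (by linarith))
  exact mul_nonneg (Real.rpow_nonneg (hp.le.trans hs.1) _) (by linarith [h1 (s • x)])

theorem fderiv_radialIntegral_le {E : Type} [NormedAddCommGroup E] [NormedSpace ℝ E]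
    [ProperSpace E] {g : E → ℝ} (hg : ContDiff ℝ 3 g) (hr₀ : 0 < r₀) (hr₀1 : r₀ ≤ 1)
    (hr₁ : 4 ≤ r₁) (hlow : ∀ x, ‖x‖ ≤ r₀ → g x = 1) (hup : ∀ x, r₁ ≤ ‖x‖ → g x = b) {x v : E}
    (hx : x ≠ 0) (hv0 : ∀ s : ℝ, 0 < s → fderiv ℝ g (s • x) v ≤ 0)
    (hv1 : ∀ s : ℝ, 0 < s → 2 ≤ ‖s • x‖ → ‖s • x‖ ≤ 3 → fderiv ℝ g (s • x) v ≤ -1) :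
    fderiv ℝ (radialIntegral g) x v ≤ -(1 / 3) := by
  have hx0 : 0 < ‖x‖ := norm_pos_iff.2 hx
  obtain ⟨p, q, hp, hpq, hpx, hqx, hev⟩ := exists_radial_interval hr₀ (by linarith : r₀ ≤ r₁) hx
  have h1 : radialIntegral g =ᶠ[𝓝 x] fun x =>
      (∫ s in p..q, s ^ (-2 : ℝ) • (g (s • x) - 1)) + q⁻¹ * (b - 1) := by
    filter_upwards [hev] with x hx
    exact radialIntegral_eq hg.continuous hlow hup hp hpq hx.1 hx.2
  have h2 := (hasFDerivAt_integral_comp_smul (Φ := fun x => g x - 1)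
    ((hg.of_le (by norm_num)).sub contDiff_const) (continuousOn_rpow_uIcc hp hpq (-2)) x).add_const
    (q⁻¹ * (b - 1))
  have hdg : Continuous (fderiv ℝ g) := hg.continuous_fderiv (by norm_num)
  have hcont : ∀ p' q' : ℝ, 0 < p' → p' ≤ q' →
      ContinuousOn (fun s : ℝ => (s ^ (-2 : ℝ) * s) • fderiv ℝ g (s • x)) (uIcc p' q') :=
    fun p' q' hp' hpq' => ((continuousOn_rpow_uIcc hp' hpq' _).mul continuousOn_id).smul
      (by fun_prop)
  rw [h1.fderiv_eq, h2.fderiv]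
  simp only [fderiv_sub_const]
  rw [ContinuousLinearMap.intervalIntegral_apply (hcont p q hp hpq).intervalIntegrable]
  simp only [smul_apply, smul_eq_mul]
  set ψ : ℝ → ℝ := fun s => s ^ (-2 : ℝ) * s * fderiv ℝ g (s • x) v with hψ
  have hint : ∀ p' q' : ℝ, 0 < p' → p' ≤ q' → IntervalIntegrable ψ volume p' q' := by
    intro p' q' hp' hpq'
    refine ContinuousOn.intervalIntegrable ?_
    refine ((continuousOn_rpow_uIcc hp' hpq' _).mul continuousOn_id).mul ?_
    exact Continuous.continuousOn (by fun_prop)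
  have hψ0 : ∀ s, 0 < s → ψ s ≤ 0 := fun s hs =>
    mul_nonpos_of_nonneg_of_nonpos (mul_nonneg (Real.rpow_nonneg hs.le _) hs.le) (hv0 s hs)
  have hneg : ∀ p' q' : ℝ, 0 < p' → p' ≤ q' → ∫ s in p'..q', ψ s ≤ 0 := by
    intro p' q' hp' hpq'
    have := intervalIntegral.integral_mono_on hpq' (hint p' q' hp' hpq')
      (intervalIntegrable_const (c := (0 : ℝ))) fun s hs => hψ0 s (hp'.trans_le hs.1)
    simpa using this
  -- The scales in `[l, u]` are those for which `s • x` lies in the shell of strict decrease. There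
  -- the weight `s⁻¹` is at least `‖x‖ / 3` and the length is `1 / ‖x‖`, which gives `1 / 3`
  -- independently of `x`.
  set l := 2 / ‖x‖ with hl
  set u := 3 / ‖x‖ with hu
  have hl0 : 0 < l := by positivity
  have hlu : l ≤ u := by rw [hl, hu]; gcongr; norm_num
  have hpl : p ≤ l := by
    rw [hl, le_div_iff₀ hx0]
    linarith
  have huq : u ≤ q := by
    rw [hu, div_le_iff₀ hx0]
    linarith
  have hu0 : 0 < u := hl0.trans_le hlu
  have hmid : ∫ s in l..u, ψ s ≤ -(1 / 3) := by
    have h3 := intervalIntegral.integral_mono_on hlu (hint l u hl0 hlu)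
      (intervalIntegrable_const (c := -(‖x‖ / 3))) fun s hs => by
        have hs0 : 0 < s := hl0.trans_le hs.1
        have hsx : ‖s • x‖ = s * ‖x‖ := by rw [norm_smul, Real.norm_of_nonneg hs0.le]
        have h4 : 2 ≤ s * ‖x‖ := (div_le_iff₀ hx0).1 hs.1
        have h5 : s * ‖x‖ ≤ 3 := (le_div_iff₀ hx0).1 hs.2
        have h6 := hv1 s hs0 (by rw [hsx]; exact h4) (by rw [hsx]; exact h5)
        have h7 : s ^ (-2 : ℝ) * s = s⁻¹ := by
          rw [← Real.rpow_add_one hs0.ne', ← Real.rpow_neg_one]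
          norm_num
        have h8 : ‖x‖ / 3 ≤ s⁻¹ := by
          rw [inv_eq_one_div, div_le_div_iff₀ (by norm_num) hs0]
          linarith
        simp only [hψ, h7]
        have : 0 < s⁻¹ := inv_pos.2 hs0
        nlinarith
    refine h3.trans_eq ?_
    rw [intervalIntegral.integral_const, hl, hu, smul_eq_mul]
    field_simp
    norm_num
  rw [← intervalIntegral.integral_add_adjacent_intervals (hint p l hp hpl)
    (hint l q hl0 (hlu.trans huq)), ← intervalIntegral.integral_add_adjacent_intervals
    (hint l u hl0 hlu) (hint u q hu0 huq)]
  linarith [hneg p l hp hpl, hneg u q hu0 huq]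

end RadialIntegral

/-! ### Unique differentiability on the cone and bounds from homogeneity -/

theorem convex_polyCone {n N : ℕ} (nor : Fin N → EuclideanSpace ℝ (Fin n)) :
    Convex ℝ (polyCone nor) := by
  intro x hx y hy a b ha hb _ i
  rw [inner_add_left, real_inner_smul_left, real_inner_smul_left]
  exact add_nonneg (mul_nonneg ha (hx i)) (mul_nonneg hb (hy i))

theorem CompletelyS.interior_polyCone_nonempty {n N : ℕ}
    {nor dir : Fin N → EuclideanSpace ℝ (Fin n)} (hS : CompletelyS nor dir) :
    (interior (polyCone nor)).Nonempty := by
  rcases isEmpty_or_nonempty (Fin N) with hN | ⟨⟨i⟩⟩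
  · have : polyCone nor = univ := eq_univ_of_forall fun x i => hN.elim i
    rw [this, interior_univ]
    exact univ_nonempty
  · obtain ⟨v, -, hv⟩ := hS univ ⟨i, mem_univ i⟩
    have ho : IsOpen {x : EuclideanSpace ℝ (Fin n) | ∀ i, 0 < ⟪x, nor i⟫} := by
      simp only [ofPred_forall]
      exact isOpen_iInter_of_finite fun i => isOpen_lt continuous_const (by fun_prop)
    exact ⟨v, interior_maximal (fun x hx i => (hx i).le) ho fun i => hv i (mem_univ i)⟩

theorem CompletelyS.uniqueDiffOn {n N : ℕ} {nor dir : Fin N → EuclideanSpace ℝ (Fin n)}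
    (hS : CompletelyS nor dir) : UniqueDiffOn ℝ (polyCone nor \ {0}) := by
  rw [sdiff_eq]
  exact (uniqueDiffOn_convex (convex_polyCone nor) hS.interior_polyCone_nonempty).inter
    isOpen_compl_singleton

theorem exists_bound_of_continuousAt_sphere {E F : Type*} [NormedAddCommGroup E]
    [ProperSpace E] [NormedAddCommGroup F] {Φ : E → F}
    (hΦ : ∀ x, x ≠ 0 → ContinuousAt Φ x) : ∃ C : ℝ, 0 < C ∧ ∀ x, ‖x‖ = 1 → ‖Φ x‖ ≤ C := by
  obtain ⟨C, hC⟩ := (isCompact_sphere (0 : E) 1).exists_bound_of_continuousOn (f := Φ) fun x hx =>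
    (hΦ x (ne_zero_of_mem_unit_sphere ⟨x, hx⟩)).continuousWithinAt
  exact ⟨max C 1, lt_max_of_lt_right one_pos, fun x hx =>
    (hC x (mem_sphere_zero_iff_norm.2 hx)).trans (le_max_left _ _)⟩

theorem norm_inv_smul_self {E : Type*} [NormedAddCommGroup E] [NormedSpace ℝ E] {x : E} (hx : x ≠ 0) : ‖‖x‖⁻¹ • x‖ = 1 := by
  rw [norm_smul, norm_inv, norm_norm, inv_mul_cancel₀ (norm_ne_zero_iff.2 hx)]

section Homogeneous

variable {E : Type*} [NormedAddCommGroup E] [NormedSpace ℝ E] [ProperSpace E] {f : E → ℝ}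

theorem exists_fderiv_bound (hf : ∀ s : ℝ, 0 < s → ∀ x, f (s • x) = s * f x)
    (hsm : ∀ x, x ≠ 0 → ContDiffAt ℝ 2 f x) :
    ∃ C : ℝ, 0 < C ∧ ∀ x, x ≠ 0 → ‖fderiv ℝ f x‖ ≤ C := by
  obtain ⟨C, hC0, hC⟩ := exists_bound_of_continuousAt_sphere fun x hx =>
    ((hsm x hx).fderiv_right (m := 1) (by norm_num)).continuousAt
  refine ⟨C, hC0, fun x hx => ?_⟩
  rw [← fderiv_smul_of_homogeneous hf (inv_pos.2 (norm_pos_iff.2 hx))]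
  exact hC _ (norm_inv_smul_self hx)

/-- The gradient is homogeneous of degree zero, so the second derivative has degree `-1` and is
controlled by its maximum on the unit sphere. -/
theorem exists_fderiv_fderiv_bound (hf : ∀ s : ℝ, 0 < s → ∀ x, f (s • x) = s * f x)
    (hsm : ∀ x, x ≠ 0 → ContDiffAt ℝ 2 f x) :
    ∃ C : ℝ, 0 < C ∧ ∀ x, x ≠ 0 → ‖fderiv ℝ (fderiv ℝ f) x‖ ≤ C / ‖x‖ := by
  obtain ⟨C, hC0, hC⟩ := exists_bound_of_continuousAt_sphere fun x hx =>
    (((hsm x hx).fderiv_right (m := 1) (by norm_num)).fderiv_right (m := 0)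
      (by norm_num)).continuousAt
  refine ⟨C, hC0, fun x hx => ?_⟩
  have hx0 : 0 < ‖x‖ := norm_pos_iff.2 hx
  have h1 := hC _ (norm_inv_smul_self hx)
  rw [fderiv_smul_of_invariant (fun s hs x => fderiv_smul_of_homogeneous hf hs x)
    (inv_pos.2 hx0), inv_inv, norm_smul, norm_norm] at h1
  rw [le_div_iff₀ hx0]
  linarith

theorem exists_mul_norm_le [Nontrivial E] (hf : ∀ s : ℝ, 0 < s → ∀ x, f (s • x) = s * f x)
    (hcont : ∀ x, x ≠ 0 → ContinuousAt f x) (hpos : ∀ x, x ≠ 0 → 0 < f x) :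
    ∃ C : ℝ, 0 < C ∧ ∀ x, x ≠ 0 → C * ‖x‖ ≤ f x := by
  obtain ⟨z, hz, hmin⟩ := (isCompact_sphere (0 : E) 1).exists_isMinOn
    (NormedSpace.sphere_nonempty.2 zero_le_one) (f := f) fun x hx =>
      (hcont x (ne_zero_of_mem_unit_sphere ⟨x, hx⟩)).continuousWithinAt
  refine ⟨f z, hpos z (ne_zero_of_mem_unit_sphere ⟨z, hz⟩), fun x hx => ?_⟩
  have hx0 : 0 < ‖x‖ := norm_pos_iff.2 hx
  have h1 : f z ≤ f (‖x‖⁻¹ • x) := hmin (mem_sphere_zero_iff_norm.2 (norm_inv_smul_self hx))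
  rw [hf _ (inv_pos.2 hx0), inv_mul_eq_div, le_div_iff₀ hx0] at h1
  exact h1

end Homogeneous

end SkorohodLyapunov

/-! ### The Lyapunov function -/

theorem theorem3p3 {n N : ℕ} (nor dir : Fin N → EuclideanSpace ℝ (Fin n))
    (hnor : ∀ i, ‖nor i‖ = 1) (hdir : ∀ i, ‖dir i‖ = 1) (hpos : ∀ i, 0 < ⟪dir i, nor i⟫)
    (hvertex : SkorohodLyapunov.ProperVertex (SkorohodLyapunov.polyCone nor))
    (hS : SkorohodLyapunov.CompletelyS nor dir)
    (hreg : SkorohodLyapunov.SkorohodRegular nor dir)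
    (C₁ : Set (EuclideanSpace ℝ (Fin n))) (hC₁ : C₁.Nonempty) (hcompact : IsCompact C₁)
    (hsub : C₁ ⊆ interior (SkorohodLyapunov.stabilityCone dir)) :
    ∃ f : EuclideanSpace ℝ (Fin n) → ℝ,
      SkorohodLyapunov.IsLyapunovFunction nor dir C₁ f ∧
      SkorohodLyapunov.RadiallyLinearOn (SkorohodLyapunov.polyCone nor) f := by
  open SkorohodLyapunov in
  obtain ⟨a₀, ha₀, -⟩ := hvertex
  have : Nontrivial (EuclideanSpace ℝ (Fin n)) :=
    ⟨a₀, 0, fun h => by simp [h] at ha₀⟩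
  obtain ⟨ε, T, V, hε, hT, hVm, hVlow, hVup, hV⟩ :=
    exists_decreasing_function hnor hdir hS hreg hcompact hsub
  obtain ⟨g, r₀, r₁, b, hg, hr₀, hr₀1, hr₁, hb, hlow, hup, hg1, hd0, hd1⟩ :=
    exists_smooth_decreasing hVm hε hT hVlow hVup hV
  set f := radialIntegral g with hfdef
  have hhom : ∀ s : ℝ, 0 < s → ∀ x, f (s • x) = s * f x := fun s hs x =>
    radialIntegral_smul g hs x
  have hr : r₀ ≤ r₁ := by linarith
  have hsm : ∀ x, x ≠ 0 → ContDiffAt ℝ 2 f x := fun x hx =>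
    contDiffAt_radialIntegral hg hr₀ hr hlow hup hx
  have hud := hS.uniqueDiffOn
  have hfd : ∀ x ∈ polyCone nor \ {0},
      fderivWithin ℝ f (polyCone nor \ {0}) x = fderiv ℝ f x := fun x hx =>
    fderivWithin_eq_fderiv (hud x hx) ((hsm x hx.2).differentiableAt (by norm_num))
  have hdec : ∀ x ∈ polyCone nor \ {0}, ∀ v ∈ C₁ ∪ constraintField nor dir x,
      fderiv ℝ f x v ≤ -(1 / 3) := by
    intro x hx v hv
    -- The constraint field is constant along rays, so `v` is admissible at every scale entering the
    -- radial integral.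
    have hv' : ∀ s : ℝ, 0 < s → v ∈ C₁ ∪ constraintField nor dir (s • x) := fun s hs => by
      rwa [constraintField_smul nor dir x hs]
    exact fderiv_radialIntegral_le hg hr₀ hr₀1 hr₁ hlow hup hx.2
      (fun s hs => hd0 _ (smul_mem_polyCone hx.1 hs.le) v (hv' s hs))
      (fun s hs h2 h3 => hd1 _ (smul_mem_polyCone hx.1 hs.le) h2 h3 v (hv' s hs))
  refine ⟨f, ⟨fun x hx => (hsm x hx.2).contDiffWithinAt, fun K hK => ?_, fun e he => ?_,
    ⟨1 / 3, by norm_num, fun r hr x hx => ?_, fun x hx v hv => ?_⟩, ?_⟩,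
    fun s hs x _ => hhom s hs x⟩
  · obtain ⟨C, hC0, hC⟩ := exists_mul_norm_le hhom (fun x hx => (hsm x hx).continuousAt)
      fun x hx => radialIntegral_pos hg.continuous hr₀ hr hb hlow hup hg1 hx
    refine ⟨K / C, div_pos hK hC0, fun x _ hx => ?_⟩
    have hx0 : x ≠ 0 := norm_pos_iff.1 ((div_pos hK hC0).trans_le hx)
    rw [div_le_iff₀ hC0] at hx
    linarith [hC x hx0]
  · obtain ⟨C, hC0, hC⟩ := exists_fderiv_fderiv_bound hhom hsm
    refine ⟨C / e, div_pos hC0 he, fun x hxG hx => ?_⟩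
    have hxp : 0 < ‖x‖ := (div_pos hC0 he).trans_le hx
    have hx0 : x ≠ 0 := norm_pos_iff.1 hxp
    rw [iteratedFDerivWithin_eq_iteratedFDeriv hud (hsm x hx0) ⟨hxG, hx0⟩,
      ← norm_iteratedFDeriv_fderiv, norm_iteratedFDeriv_one]
    refine (hC x hx0).trans ?_
    rw [div_le_iff₀ hxp]
    rw [div_le_iff₀ he] at hx
    linarith
  · rw [hfd x hx]
    exact hdec x hx r (Or.inl hr)
  · have hx' : x ∈ polyCone nor \ {0} := ⟨(isClosed_polyCone nor).frontier_subset hx.1, hx.2⟩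
    rw [hfd x hx']
    exact hdec x hx' v (Or.inr hv)
  · obtain ⟨C, hC0, hC⟩ := exists_fderiv_bound hhom hsm
    exact ⟨C, hC0, fun x hx => by rw [hfd x hx]; exact hC x hx.2⟩
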